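/- Let $E$ be a Euclidean Jordan algebra, i.e. a finite-dimensional real inner product space with a commutative bilinear product $xy$ and a unit $\mathbf e$ such that $x(x^2y)=x^2(xy)$ and $\langle x,yz\rangle=\langle xy,z\rangle$ for all $x,y,z\in E$ (any rank; the algebras whose cones are the Lorentz cones and the octonion cone are included). Let $V$ be its symmetric cone, the interior of $\{y^2 : y\in E\}$, and let $D=\{z\in V:\mathbf e-z\in V\}$. Write $L(x)y=xy$ and $P(x)=2L(x)^2-L(x^2)$. For a spectral decomposition $x=\sum_{i=1}^r\lambda_i c_i$ along a complete system $c_1,\dots,c_r$ of primitive orthogonal idempotents put $\det x=\prod_i\lambda_i$ and, for $x\in V$, $x^{-1/2}=\sum_i\lambda_i^{-1/2}c_i$. Let $a,b,c:V\to\mathbb R$ and $d:D\to\mathbb R$ be continuous functions such that $$a(x)+b(y)=c(x+y)+d\bigl(P((x+y)^{-1/2})x\bigr)\qquad\text{for all }x,y\in V.$$ Then there exist constants $k_1,k_2\in\mathbb R$, an element $\Lambda\in E$, and continuous functions $e,f,g:V\to\mathbb R$ and $h:D\to\mathbb R$ such that for all $x\in V$ and $u\in D$ $$\begin{aligned} a(x)&=\langle\Lambda,x\rangle+k_1\log\det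 x+e(x),\\ b(x)&=\langle\Lambda,x\rangle+k_2\log\det x+f(x),\\ c(x)&=\langle\Lambda,x\rangle+(k_1+k_2)\log\det x+g(x),\\ d(u)&=k_1\log\det u+k_2\log\det(\mathbf e-u)+h(u), \end{aligned}$$ where $$e(x)+f(y)=g(x+y)+h\bigl(P((x+y)^{-1/2})x\bigr)\qquad\text{for all }x,y\in V,$$ and $e(sx)=e(x)$, $f(sx)=f(x)$, $g(sx)=g(x)$ for all $s>0$ and $x\in V$. -/

import Mathlib

/-- A Euclidean Jordan algebra: a finite-dimensional real inner product space with a bilinear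
product `(x, y) ↦ L x y` and a unit `one`, such that the product is commutative, satisfies the
Jordan identity, and every multiplication operator `L x` is symmetric. -/
class EuclideanJordanAlgebra (E : Type*) [NormedAddCommGroup E] [InnerProductSpace ℝ E]
    [FiniteDimensional ℝ E] where
  /-- The Jordan product: `L x y` is the product of `x` and `y`. -/
  L : E →ₗ[ℝ] E →ₗ[ℝ] E
  /-- The neutral element. -/
  one : E
  mul_comm : ∀ x y : E, L x y = L y x
  jordan : ∀ x y : E, L x (L (L x x) y) = L (L x x) (L x y)
  mul_one : ∀ x : E, L x one = x
  inner_mul : ∀ x y z : E, inner ℝ x (L y z) = inner ℝ (L x y) z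

namespace EuclideanJordanAlgebra

noncomputable section

variable {E : Type*} [NormedAddCommGroup E] [InnerProductSpace ℝ E] [FiniteDimensional ℝ E]
  [EuclideanJordanAlgebra E]

/-- The quadratic representation `P x = 2 (L x)² - L (x²)`. -/
def P (x : E) : E →ₗ[ℝ] E :=
  (2 : ℝ) • (L x ∘ₗ L x) - L (L x x)

variable (E) in
/-- The symmetric cone: the interior of the set of Jordan squares. -/
def cone : Set E :=
  interior {x : E | ∃ y : E, x = L y y}

variable (E) in
/-- The set `D` of those `z` in the cone for which `one - z` is in the cone. -/
def unitInterval : Set E :=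
  {z : E | z ∈ cone E ∧ one - z ∈ cone E}

/-- An idempotent, possibly zero. -/
def IsIdempotent (c : E) : Prop := L c c = c

/-- A nonzero idempotent that is not the sum of two nonzero idempotents. -/
def IsPrimitiveIdempotent (c : E) : Prop :=
  IsIdempotent c ∧ c ≠ 0 ∧
    ¬ ∃ p q : E, IsIdempotent p ∧ p ≠ 0 ∧ IsIdempotent q ∧ q ≠ 0 ∧ c = p + q

/-- A spectral decomposition `x = ∑ i, eigenvalue i • idem i` along a complete system of primitive
orthogonal idempotents. -/
structure SpectralDecomposition (x : E) where
  /-- The number of idempotents, which is the rank of the algebra. -/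
  r : ℕ
  /-- The complete system of primitive orthogonal idempotents. -/
  idem : Fin r → E
  /-- The eigenvalues, listed with multiplicity. -/
  eigenvalue : Fin r → ℝ
  primitive : ∀ i, IsPrimitiveIdempotent (idem i)
  orthogonal : ∀ i j, i ≠ j → L (idem i) (idem j) = 0
  sum_idem : ∑ i, idem i = one
  sum_eq : x = ∑ i, eigenvalue i • idem i

open Classical in
/-- The determinant: the product of the eigenvalues in a spectral decomposition. Every element of
a Euclidean Jordan algebra has one, and the product does not depend on which one is taken, so
the value `0` of the other branch is never used. -/
def det (x : E) : ℝ :=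
  if h : Nonempty (SpectralDecomposition x) then ∏ i, h.some.eigenvalue i else 0

open Classical in
/-- The real power `x ^ p` of an element of the cone: `∑ i, (eigenvalue i) ^ p • idem i` for a
spectral decomposition of `x`. It does not depend on the decomposition that is taken. -/
def power (x : E) (p : ℝ) : E :=
  if h : Nonempty (SpectralDecomposition x) then
    ∑ i, (h.some.eigenvalue i) ^ p • h.some.idem i
  else 0

/-- The Olkin–Baker equation
`a(x) + b(y) = c(x + y) + d(P((x + y)^(-1/2)) x)` for all `x`, `y` in the cone. -/
def OlkinBaker (a b c d : E → ℝ) : Prop :=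
  ∀ x ∈ cone E, ∀ y ∈ cone E,
    a x + b y = c (x + y) + d (P (power (x + y) (-1 / 2)) x)

end

end EuclideanJordanAlgebra

namespace EuclideanJordanAlgebra

noncomputable section

/-! Replacing `(x, y)` by `(s x, s y)` does not change the argument of `d`, so subtraction
eliminates `d`: the increments of `a`, `b`, `c` under a dilation solve Pexider's equation on an open
convex cone. They are therefore affine with a common linear part `⟨w s, ·⟩`. Composing dilations in
either order forces `w s = (s - 1) w 2`, and makes the constants multiples `κ log s`. Take `Λ = w
2`; since `log det (s x) = rank * log s + log det x`, the coefficients of `log det` are `κ / rank`,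
and what remains is invariant under dilations. The subtracted functions satisfy the equation
themselves: for `z = x + y` one has `e - P(z^(-1/2)) x = P(z^(-1/2)) y` and `log det P(z^(-1/2)) x =
log det x - log det z` (`exists_dilation_increments`, `log_det_P_power`).

Most of the work shows that `log det`, defined through an arbitrary choice of decomposition, is
continuous and transforms in this way. Both facts are read off from the operator determinant of `P`,
for which `|Det P(∑ λᵢ cᵢ)| = ∏ |λᵢ|^(2 tr L(cᵢ))`, and which is multiplicative by the fundamental
formula `P_P`. The weights `tr L(cᵢ)` may differ between ideals, so the algebra is split by central
idempotents, one for each value of the trace, and `logDet` adds up the normalized contributions. -/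

/-! ### Determinant and trace of a diagonalized operator. -/

theorem det_eq_prod_of_basis {V ι : Type*} [AddCommGroup V] [Module ℝ V] [Fintype ι]
    (b : Module.Basis ι ℝ V) {f : V →ₗ[ℝ] V} {m : ι → ℝ}
    (h : ∀ i, f (b i) = m i • b i) : LinearMap.det f = ∏ i, m i := by
  classical
  have : LinearMap.toMatrix b b f = Matrix.diagonal m := by
    ext i j
    rw [LinearMap.toMatrix_apply, h, map_smul, Finsupp.smul_apply, b.repr_self,
      Finsupp.single_apply, Matrix.diagonal_apply]
    by_cases hij : i = j
    · simp [hij]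
    · simp [hij, Ne.symm hij]
  rw [← LinearMap.det_toMatrix b, this, Matrix.det_diagonal]

theorem trace_eq_sum_of_basis {V ι : Type*} [AddCommGroup V] [Module ℝ V] [Fintype ι]
    (b : Module.Basis ι ℝ V) {f : V →ₗ[ℝ] V} {m : ι → ℝ}
    (h : ∀ i, f (b i) = m i • b i) : LinearMap.trace ℝ V f = ∑ i, m i := by
  classical
  rw [LinearMap.trace_eq_matrix_trace ℝ b, Matrix.trace]
  refine Finset.sum_congr rfl fun i _ => ?_
  rw [Matrix.diag_apply, LinearMap.toMatrix_apply, h, map_smul, Finsupp.smul_apply, b.repr_self]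
  simp

variable {E : Type*} [NormedAddCommGroup E] [InnerProductSpace ℝ E] [FiniteDimensional ℝ E]
  [EuclideanJordanAlgebra E]

/-! ### Linearized Jordan identities -/

theorem one_mul (x : E) : L one x = x := by rw [mul_comm, mul_one]

theorem L_one : (L (one : E) : Module.End ℝ E) = 1 := LinearMap.ext one_mul

theorem L_isSymmetric (x : E) : (L x : Module.End ℝ E).IsSymmetric := fun y z => by
  rw [mul_comm x y, ← inner_mul]

/-- The part of the Jordan identity at `x + z` that is linear in `z`: the difference with `x - z`
keeps the odd part, and the identity at `z` removes the cubic term. -/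
theorem jordan_polarized (x z y : E) :
    (2 : ℝ) • L x (L (L x z) y) + L z (L (L x x) y) =
      (2 : ℝ) • L (L x z) (L x y) + L (L x x) (L z y) := by
  have h₁ := jordan (x + z) y
  have h₂ := jordan (x - z) y
  have h₃ := jordan z y
  have hc := mul_comm z x
  simp only [map_add, map_sub, LinearMap.add_apply, LinearMap.sub_apply, hc] at h₁ h₂
  linear_combination (norm := module) (1 / 2 : ℝ) • h₁ - (1 / 2 : ℝ) • h₂ - h₃

theorem jordan_linearized (x y z w : E) :
    L x (L (L y z) w) + L y (L (L z x) w) + L z (L (L x y) w) =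
      L (L y z) (L x w) + L (L z x) (L y w) + L (L x y) (L z w) := by
  have h₁ := jordan_polarized (x + y) z w
  have h₂ := jordan_polarized x z w
  have h₃ := jordan_polarized y z w
  have hc := mul_comm y x
  have hc' := mul_comm z x
  simp only [map_add, LinearMap.add_apply, hc] at h₁
  rw [hc']
  linear_combination (norm := module) (1 / 2 : ℝ) • h₁ - (1 / 2 : ℝ) • h₂ - (1 / 2 : ℝ) • h₃

/-- `jordan_linearized`, read as an identity between operators acting on its second variable `y`
instead of on `w`. -/
theorem L_mul_L_mul_L (x w z : E) :
    (L x * L w * L z + L z * L w * L x + L (L (L z x) w) : Module.End ℝ E) =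
      L (L x w) * L z + L (L z x) * L w + L (L z w) * L x := by
  ext y
  have h := jordan_linearized x y z w
  simp only [LinearMap.add_apply, Module.End.mul_apply]
  rw [mul_comm w (L z y), mul_comm w (L x y), mul_comm (L (L z x) w) y, mul_comm (L x w) (L z y),
    mul_comm w y, mul_comm (L z w) (L x y), mul_comm z y]
  linear_combination (norm := module) h

theorem commute_L_L_sq (x : E) : Commute (L x : Module.End ℝ E) (L (L x x)) :=
  LinearMap.ext fun y => jordan x y

/-! ### The fundamental formula -/

/-- The polarization of the quadratic representation. -/
def polarP (u v : E) : Module.End ℝ E := L u * L v + L v * L u - L (L u v)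

theorem polarP_self (x : E) : polarP x x = P x := by
  ext y
  simp only [polarP, P, LinearMap.sub_apply, LinearMap.add_apply, LinearMap.smul_apply,
    Module.End.mul_apply, LinearMap.comp_apply]
  module

theorem P_apply (x y : E) : P x y = (2 : ℝ) • L x (L x y) - L (L x x) y := rfl

theorem polarP_add_left (u u' v : E) : polarP (u + u') v = polarP u v + polarP u' v := by
  simp only [polarP, map_add, LinearMap.add_apply, add_mul, mul_add]; abel

theorem polarP_comm (u v : E) : polarP u v = polarP v u := by
  rw [polarP, polarP, mul_comm u v, add_comm]

theorem polarP_add_right (u v v' : E) : polarP u (v + v') = polarP u v + polarP u v' := by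
  rw [polarP_comm, polarP_add_left, polarP_comm v, polarP_comm v']

theorem polarP_smul_left (t : ℝ) (u v : E) : polarP (t • u) v = t • polarP u v := by
  simp only [polarP, map_smul, LinearMap.smul_apply, smul_mul_assoc, mul_smul_comm, smul_add,
    smul_sub]

theorem polarP_smul_right (t : ℝ) (u v : E) : polarP u (t • v) = t • polarP u v := by
  rw [polarP_comm, polarP_smul_left, polarP_comm]

theorem two_polarP_mul_self (x y : E) :
    (2 : ℝ) • polarP (L y x) x = L y * P x + P x * L y := by
  ext w
  have h₁ := LinearMap.congr_fun (L_mul_L_mul_L x x y) w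
  have h₂ := jordan_polarized x y w
  rw [mul_comm x y] at h₂
  simp only [LinearMap.sub_apply, LinearMap.add_apply, LinearMap.smul_apply, polarP, P,
    Module.End.mul_apply, LinearMap.comp_apply, map_sub, map_smul, smul_sub, smul_add] at h₁ ⊢
  linear_combination (norm := module) h₂ - (2 : ℝ) • h₁

/-- `L y` is in the Lie algebra of the structure group. -/
theorem polarP_mul_add (y u v : E) :
    polarP (L y u) v + polarP u (L y v) = L y * polarP u v + polarP u v * L y := by
  have h₁ := two_polarP_mul_self (u + v) y
  have h₂ := two_polarP_mul_self u y
  have h₃ := two_polarP_mul_self v y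
  have hc := polarP_comm (L y v) u
  have hc' := polarP_comm v u
  simp only [← polarP_self, map_add, polarP_add_left, polarP_add_right, mul_add, add_mul,
    smul_add, hc, hc'] at h₁ h₂ h₃ ⊢
  linear_combination (norm := module) (1 / 2 : ℝ) • h₁ - (1 / 2 : ℝ) • h₂ - (1 / 2 : ℝ) • h₃

/-- Together with `L_fourth`, this makes a joint eigenvector of `L y` and `L (y²)` an eigenvector of
`L (y³)` and `L (y⁴)` as well. -/
theorem L_cube (x : E) : (L (L x (L x x)) : Module.End ℝ E) =
    (3 : ℝ) • (L (L x x) * L x) - (2 : ℝ) • (L x * L x * L x) := by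
  have h := L_mul_L_mul_L x x x
  rw [mul_comm (L x x) x] at h
  linear_combination (norm := module) h

theorem L_fourth (x : E) : (L (L x (L x (L x x))) : Module.End ℝ E) =
    L (L x x) * L (L x x) + (2 : ℝ) • (L (L x (L x x)) * L x)
      - L x * L x * L (L x x) - L (L x x) * L x * L x := by
  have h := L_mul_L_mul_L x x (L x x)
  rw [mul_comm (L x x) x, mul_comm (L x (L x x)) x] at h
  linear_combination (norm := module) h

theorem polarP_isSymmetric (u v : E) : (polarP u v).IsSymmetric := fun y z => by
  simp only [polarP, LinearMap.sub_apply, LinearMap.add_apply, Module.End.mul_apply,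
    inner_sub_left, inner_add_left, inner_sub_right, inner_add_right, L_isSymmetric u _ _,
    L_isSymmetric v _ _, L_isSymmetric (L u v) _ _]
  ring

theorem P_isSymmetric (x : E) : (P x).IsSymmetric := polarP_self x ▸ polarP_isSymmetric x x

/-- The joint eigenvectors of `L y` and `L (y²)`. -/
def jointEigenvectors (y : E) : Set E :=
  {u | ∃ a c : ℝ, L y u = a • u ∧ L (L y y) u = c • u}

theorem span_jointEigenvectors (y : E) : Submodule.span ℝ (jointEigenvectors y) = ⊤ := by
  rw [eq_top_iff, ← LinearMap.IsSymmetric.iSup_iSup_eigenspace_inf_eigenspace_eq_top_of_commute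
    (L_isSymmetric y) (L_isSymmetric (L y y)) (commute_L_L_sq y)]
  refine iSup_le fun a => iSup_le fun c u hu => Submodule.subset_span ⟨a, c, ?_, ?_⟩
  · exact Module.End.mem_eigenspace_iff.1 hu.1
  · exact Module.End.mem_eigenspace_iff.1 hu.2

theorem jointEigenvectors_induction {y : E} {p : E → Prop} (h : ∀ u ∈ jointEigenvectors y, p u)
    (h_zero : p 0) (h_add : ∀ u v, p u → p v → p (u + v)) (h_smul : ∀ (t : ℝ) u, p u → p (t • u))
    (u : E) : p u :=
  Submodule.span_induction (p := fun u _ => p u) h h_zero (fun u v _ _ => h_add u v)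
    (fun t u _ => h_smul t u) (span_jointEigenvectors y ▸ Submodule.mem_top (x := u))

theorem jointEigenvectors_cube {y u : E} {a c : ℝ} (h₁ : L y u = a • u)
    (h₂ : L (L y y) u = c • u) : L (L y (L y y)) u = (3 * a * c - 2 * a ^ 3) • u := by
  simp only [L_cube, LinearMap.sub_apply, LinearMap.smul_apply, Module.End.mul_apply, h₁, h₂,
    map_smul]
  module

theorem jointEigenvectors_fourth {y u : E} {a c : ℝ} (h₁ : L y u = a • u)
    (h₂ : L (L y y) u = c • u) :
    L (L y (L y (L y y))) u = (c ^ 2 + 4 * a ^ 2 * c - 4 * a ^ 4) • u := by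
  simp only [L_fourth, LinearMap.sub_apply, LinearMap.add_apply, LinearMap.smul_apply,
    Module.End.mul_apply, h₁, h₂, map_smul, jointEigenvectors_cube h₁ h₂]
  module

theorem P_jointEigenvectors {y u : E} {a c : ℝ} (h₁ : L y u = a • u)
    (h₂ : L (L y y) u = c • u) : P y u = (2 * a ^ 2 - c) • u := by
  simp only [P_apply, h₁, h₂, map_smul]
  module

/-- A matrix entry of `polarP u v` can be nonzero only if the eigenvalues balance; this will be
applied to `y`, `y²`, `y³` and `y⁴` in turn. -/
theorem eigenvalue_add_mul_inner_polarP {y u v w w' : E} {a b s t : ℝ} (hu : L y u = a • u)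
    (hv : L y v = b • v) (hw : L y w = s • w) (hw' : L y w' = t • w') :
    (a + b) * inner ℝ (polarP u v w) w' = (s + t) * inner ℝ (polarP u v w) w' := by
  have h := congrArg (fun T : Module.End ℝ E => inner ℝ (T w) w') (polarP_mul_add y u v)
  simp only [LinearMap.add_apply, Module.End.mul_apply, hu, hv, hw, polarP_smul_left,
    polarP_smul_right, LinearMap.smul_apply, map_smul, inner_add_left, inner_smul_left,
    L_isSymmetric y _ _, hw', inner_smul_right, conj_trivial] at h
  linear_combination h

/-- Write the eigenvalues of `L y` and `L (y²)` as `(λ + μ)/2` and `(λ² + μ²)/2`. Then those of `L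
(y³)` and `L (y⁴)` are `(λ³ + μ³)/2` and `(λ⁴ + μ⁴)/2`, and that of `P y` is `λ μ`. If the matrix
entry is nonzero, the four numbers from `u, v` and the four from `w, w'` have equal power sums up to
order four, hence equal products. -/
theorem inner_polarP_P_of_mem {y u v w w' : E} (hu : u ∈ jointEigenvectors y)
    (hv : v ∈ jointEigenvectors y) (hw : w ∈ jointEigenvectors y)
    (hw' : w' ∈ jointEigenvectors y) :
    inner ℝ (polarP (P y u) (P y v) w) w' = inner ℝ ((P y * polarP u v * P y) w) w' := by
  obtain ⟨a, a₂, ha, ha₂⟩ := hu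
  obtain ⟨b, b₂, hb, hb₂⟩ := hv
  obtain ⟨s, s₂, hs, hs₂⟩ := hw
  obtain ⟨t, t₂, ht, ht₂⟩ := hw'
  have h₁ := eigenvalue_add_mul_inner_polarP ha hb hs ht
  have h₂ := eigenvalue_add_mul_inner_polarP ha₂ hb₂ hs₂ ht₂
  have h₃ := eigenvalue_add_mul_inner_polarP (jointEigenvectors_cube ha ha₂)
    (jointEigenvectors_cube hb hb₂) (jointEigenvectors_cube hs hs₂)
    (jointEigenvectors_cube ht ht₂)
  have h₄ := eigenvalue_add_mul_inner_polarP (jointEigenvectors_fourth ha ha₂)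
    (jointEigenvectors_fourth hb hb₂) (jointEigenvectors_fourth hs hs₂)
    (jointEigenvectors_fourth ht ht₂)
  simp only [Module.End.mul_apply, P_isSymmetric y _ _, P_jointEigenvectors ha ha₂,
    P_jointEigenvectors hb hb₂, P_jointEigenvectors hs hs₂, P_jointEigenvectors ht ht₂,
    polarP_smul_left, polarP_smul_right, LinearMap.smul_apply, map_smul, inner_smul_left,
    inner_smul_right, conj_trivial]
  rcases eq_or_ne (inner ℝ (polarP u v w) w') 0 with h₀ | h₀
  · simp [h₀]
  have e₁ := mul_right_cancel₀ h₀ h₁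
  have e₂ := mul_right_cancel₀ h₀ h₂
  have e₃ := mul_right_cancel₀ h₀ h₃
  have e₄ := mul_right_cancel₀ h₀ h₄
  have key : (2 * b ^ 2 - b₂) * (2 * a ^ 2 - a₂) = (2 * s ^ 2 - s₂) * (2 * t ^ 2 - t₂) := by
    -- Newton's identity for the fourth elementary symmetric polynomial in four variables
    have newton : ∀ x x₂ z z₂ : ℝ, (2 * z ^ 2 - z₂) * (2 * x ^ 2 - x₂) =
        (2 / 3) * (x + z) ^ 4 - 2 * (x + z) ^ 2 * (x₂ + z₂) + (1 / 2) * (x₂ + z₂) ^ 2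
          + (4 / 3) * (x + z) * ((3 * x * x₂ - 2 * x ^ 3) + (3 * z * z₂ - 2 * z ^ 3))
          - (1 / 2) * ((x₂ ^ 2 + 4 * x ^ 2 * x₂ - 4 * x ^ 4)
            + (z₂ ^ 2 + 4 * z ^ 2 * z₂ - 4 * z ^ 4)) := by
      intros; ring
    rw [newton, _root_.mul_comm (2 * s ^ 2 - s₂), newton, e₁, e₂, e₃, e₄]
  linear_combination (inner ℝ (polarP u v w) w') * key

theorem polarP_P (y u v : E) : polarP (P y u) (P y v) = P y * polarP u v * P y := by
  have key : ∀ w w', inner ℝ (polarP (P y u) (P y v) w) w' =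
      inner ℝ ((P y * polarP u v * P y) w) w' := by
    -- Both sides are linear in each of `u`, `v`, `w`, `w'`, so joint eigenvectors suffice.
    revert u
    refine jointEigenvectors_induction (y := y) (fun u hu => ?_) ?_ ?_ ?_
    · revert v
      refine jointEigenvectors_induction (y := y) (fun v hv => ?_) ?_ ?_ ?_
      · refine jointEigenvectors_induction (y := y) (fun w hw => ?_) ?_ ?_ ?_
        · refine jointEigenvectors_induction (y := y)
            (fun w' hw' => inner_polarP_P_of_mem hu hv hw hw') ?_ ?_ ?_
          · simp only [inner_zero_right]
          · intro x x' h h'; rw [inner_add_right, inner_add_right, h, h']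
          · intro t x h; rw [inner_smul_right, inner_smul_right, h]
        · simp only [map_zero, inner_zero_left, implies_true]
        · intro x x' h h' w'; rw [map_add, map_add, inner_add_left, inner_add_left, h, h']
        · intro t x h w'; rw [map_smul, map_smul, inner_smul_left, inner_smul_left, h]
      · intro w w'
        have h : ∀ u : E, polarP u 0 = 0 := fun u => by simpa using polarP_smul_right 0 u 0
        simp [h]
      · intro x x' h h' w w'
        simp only [map_add, polarP_add_right, mul_add, add_mul, LinearMap.add_apply,
          inner_add_left, h, h']
      · intro t x h w w'
        simp only [map_smul, polarP_smul_right, mul_smul_comm, smul_mul_assoc,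
          LinearMap.smul_apply, inner_smul_left, h]
    · intro w w'
      have h : ∀ u : E, polarP 0 u = 0 := fun u => by simpa using polarP_smul_left 0 0 u
      simp [h]
    · intro x x' h h' w w'
      simp only [map_add, polarP_add_left, mul_add, add_mul, LinearMap.add_apply,
        inner_add_left, h, h']
    · intro t x h w w'
      simp only [map_smul, polarP_smul_left, mul_smul_comm, smul_mul_assoc,
        LinearMap.smul_apply, inner_smul_left, h]
  exact LinearMap.ext fun w => ext_inner_right ℝ (key w)

/-- The fundamental formula for the quadratic representation. -/
theorem P_P (x y : E) : P (P y x) = P y * P x * P y := by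
  rw [← polarP_self, polarP_P, polarP_self]

/-! ### Idempotents -/

theorem IsIdempotent.L_cubic {c : E} (hc : IsIdempotent c) (y : E) :
    (2 : ℝ) • L c (L c (L c y)) = (3 : ℝ) • L c (L c y) - L c y := by
  have h := LinearMap.congr_fun (L_cube c) y
  rw [hc, hc] at h
  simp only [LinearMap.sub_apply, LinearMap.smul_apply, Module.End.mul_apply] at h
  linear_combination (norm := module) h

/-- On the roots `0, 1/2, 1` of `L_cubic` one has `λ = (2λ² - λ)² + 8(λ - λ²)²`, which exhibits `L
c` as a sum of squares. -/
theorem IsIdempotent.inner_mul_self_eq {c : E} (hc : IsIdempotent c) (y : E) :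
    inner ℝ (L c y) y = ‖(2 : ℝ) • L c (L c y) - L c y‖ ^ 2 + 8 * ‖L c y - L c (L c y)‖ ^ 2 := by
  have h₁ : inner ℝ (L c (L c y)) y = inner ℝ (L c y) (L c y) := L_isSymmetric c _ _
  have h₂ : inner ℝ (L c (L c (L c y))) y = inner ℝ (L c y) (L c (L c y)) := by
    rw [L_isSymmetric c, real_inner_comm]
  have h₃ : inner ℝ (L c (L c y)) (L c (L c y)) = inner ℝ (L c y) (L c (L c (L c y))) :=
    L_isSymmetric c _ _
  have e₁ := congrArg (fun v => inner ℝ v y) (hc.L_cubic y)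
  have e₂ := congrArg (fun v => inner ℝ (L c y) v) (hc.L_cubic y)
  simp only [inner_sub_left, inner_sub_right, inner_smul_left, inner_smul_right,
    conj_trivial] at e₁ e₂
  rw [← real_inner_self_eq_norm_sq, ← real_inner_self_eq_norm_sq]
  simp only [inner_sub_left, inner_sub_right, inner_smul_left, inner_smul_right, conj_trivial]
  rw [real_inner_comm (L c y) (L c (L c y))]
  rw [h₁, h₂] at e₁
  rw [h₃]
  linarith

theorem IsIdempotent.inner_mul_self_nonneg {c : E} (hc : IsIdempotent c) (y : E) :
    0 ≤ inner ℝ (L c y) y := by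
  rw [hc.inner_mul_self_eq]; positivity

theorem IsIdempotent.mul_eq_zero_of_inner_eq_zero {c : E} (hc : IsIdempotent c) {y : E}
    (h : inner ℝ (L c y) y = 0) : L c y = 0 := by
  rw [hc.inner_mul_self_eq] at h
  have h₁ : ‖(2 : ℝ) • L c (L c y) - L c y‖ ^ 2 = 0 := by
    nlinarith [sq_nonneg ‖(2 : ℝ) • L c (L c y) - L c y‖, sq_nonneg ‖L c y - L c (L c y)‖]
  have h₂ : ‖L c y - L c (L c y)‖ ^ 2 = 0 := by
    nlinarith [sq_nonneg ‖(2 : ℝ) • L c (L c y) - L c y‖, sq_nonneg ‖L c y - L c (L c y)‖]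
  rw [pow_eq_zero_iff two_ne_zero, norm_eq_zero] at h₁ h₂
  linear_combination (norm := module) h₁ + (2 : ℝ) • h₂

theorem IsIdempotent.inner_mul_self_right {d : E} (hd : IsIdempotent d) (x : E) :
    inner ℝ (L x d) d = inner ℝ x d := by
  rw [← inner_mul, hd]

theorem IsIdempotent.inner_nonneg {c d : E} (hc : IsIdempotent c) (hd : IsIdempotent d) :
    0 ≤ inner ℝ c d := by
  rw [← hd.inner_mul_self_right]; exact hc.inner_mul_self_nonneg d

theorem IsIdempotent.mul_eq_zero_iff {c d : E} (hc : IsIdempotent c) (hd : IsIdempotent d) :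
    L c d = 0 ↔ inner ℝ c d = 0 := by
  rw [← hd.inner_mul_self_right]
  exact ⟨fun h => by rw [h, inner_zero_left], hc.mul_eq_zero_of_inner_eq_zero⟩

theorem inner_one_left (x : E) (hx : IsIdempotent x) : inner ℝ one x = inner ℝ x x := by
  rw [← hx.inner_mul_self_right, one_mul]

theorem isIdempotent_one : IsIdempotent (one : E) := mul_one one

theorem IsIdempotent.sub {c d : E} (hc : IsIdempotent c) (hd : IsIdempotent d) (h : L c d = d) :
    IsIdempotent (c - d) := by
  have h' : L d c = d := by rw [mul_comm, h]
  unfold IsIdempotent at *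
  simp only [map_sub, LinearMap.sub_apply, hc, hd, h, h']
  abel

theorem IsIdempotent.mul_eq_zero_of_add {p q : E} (hp : IsIdempotent p) (hq : IsIdempotent q)
    (h : IsIdempotent (p + q)) : L p q = 0 := by
  have h' := mul_comm q p
  unfold IsIdempotent at *
  simp only [map_add, LinearMap.add_apply, hp, hq, h'] at h
  have : (2 : ℝ) • L p q = 0 := by linear_combination (norm := module) h
  simpa using this

variable (E) in
theorem exists_norm_mul_le : ∃ K : ℝ, 0 < K ∧ ∀ x y : E, ‖L x y‖ ≤ K * ‖x‖ * ‖y‖ := by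
  let f : E →L[ℝ] E →L[ℝ] E := LinearMap.toContinuousLinearMap
    ((LinearMap.toContinuousLinearMap : (E →ₗ[ℝ] E) ≃ₗ[ℝ] (E →L[ℝ] E)).toLinearMap ∘ₗ L)
  refine ⟨‖f‖ + 1, by positivity, fun x y => (f.le_opNorm₂ x y).trans ?_⟩
  gcongr; linarith

variable (E) in
theorem exists_le_norm_of_isIdempotent :
    ∃ δ : ℝ, 0 < δ ∧ ∀ c : E, IsIdempotent c → c ≠ 0 → δ ≤ ‖c‖ := by
  obtain ⟨K, hK, h⟩ := exists_norm_mul_le E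
  refine ⟨K⁻¹, inv_pos.2 hK, fun c hc h₀ => ?_⟩
  have h₁ := h c c
  rw [hc] at h₁
  have h₂ := norm_pos_iff.2 h₀
  rw [inv_le_iff_one_le_mul₀' hK]
  nlinarith

/-- Splitting `c = p + q` is orthogonal, so each summand loses at least `δ²` of `‖c‖²` and the
process stops. The pieces of `p` and `q` are mutually orthogonal because their inner products are
nonnegative and add up to `⟨p, q⟩ = 0`. -/
theorem exists_primitive_decomposition {c : E} (hc : IsIdempotent c) :
    ∃ S : Finset E, (∀ d ∈ S, IsPrimitiveIdempotent d) ∧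
      (∀ d ∈ S, ∀ d' ∈ S, d ≠ d' → L d d' = 0) ∧ ∑ d ∈ S, d = c := by
  classical
  obtain ⟨δ, hδ, hle⟩ := exists_le_norm_of_isIdempotent E
  obtain ⟨n, hn⟩ := exists_nat_ge (‖c‖ ^ 2 / δ ^ 2)
  rw [div_le_iff₀ (by positivity)] at hn
  induction n generalizing c with
  | zero =>
    have : c = 0 := by
      have : ‖c‖ ^ 2 = 0 := le_antisymm (by simpa using hn) (by positivity)
      simpa using this
    exact ⟨∅, by simp [this]⟩
  | succ n ih =>
    by_cases hprim : IsPrimitiveIdempotent c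
    · exact ⟨{c}, by simpa using hprim, by simp, by simp⟩
    by_cases h₀ : c = 0
    · exact ⟨∅, by simp [h₀]⟩
    have hex : ∃ p q : E, IsIdempotent p ∧ p ≠ 0 ∧ IsIdempotent q ∧ q ≠ 0 ∧ c = p + q := by
      by_contra h
      exact hprim ⟨hc, h₀, h⟩
    obtain ⟨p, q, hp, hp₀, hq, hq₀, rfl⟩ := hex
    have hpq := (hp.mul_eq_zero_iff hq).1 (hp.mul_eq_zero_of_add hq hc)
    rw [norm_add_sq_real, hpq] at hn
    push_cast at hn
    have hp' := pow_le_pow_left₀ hδ.le (hle p hp hp₀) 2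
    have hq' := pow_le_pow_left₀ hδ.le (hle q hq hq₀) 2
    obtain ⟨S, hS, hSo, hSs⟩ := ih hp (by nlinarith)
    obtain ⟨S', hS', hSo', hSs'⟩ := ih hq (by nlinarith)
    have horth : ∀ d ∈ S, ∀ d' ∈ S', inner ℝ d d' = 0 := by
      have h : ∑ d ∈ S, ∑ d' ∈ S', inner ℝ d d' = 0 := by
        rw [← hpq, ← hSs, ← hSs', sum_inner]
        simp_rw [inner_sum]
      have hnn : ∀ d ∈ S, ∀ d' ∈ S', 0 ≤ inner ℝ d d' := fun d hd d' hd' =>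
        (hS d hd).1.inner_nonneg (hS' d' hd').1
      intro d hd
      have h' := (Finset.sum_eq_zero_iff_of_nonneg
        (fun d hd => Finset.sum_nonneg (hnn d hd))).1 h d hd
      exact (Finset.sum_eq_zero_iff_of_nonneg (hnn d hd)).1 h'
    have hmul : ∀ d ∈ S, ∀ d' ∈ S', L d d' = 0 := fun d hd d' hd' =>
      ((hS d hd).1.mul_eq_zero_iff (hS' d' hd').1).2 (horth d hd d' hd')
    have hdisj : Disjoint S S' := Finset.disjoint_left.2 fun d hd hd' =>
      (hS d hd).2.1 (inner_self_eq_zero.1 (horth d hd d hd'))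
    refine ⟨S ∪ S', ?_, ?_, by rw [Finset.sum_union hdisj, hSs, hSs']⟩
    · intro d hd
      exact (Finset.mem_union.1 hd).elim (hS d) (hS' d)
    · intro d hd d' hd' hne
      rcases Finset.mem_union.1 hd with h | h <;> rcases Finset.mem_union.1 hd' with h' | h'
      · exact hSo d h d' h' hne
      · exact hmul d h d' h'
      · rw [mul_comm]; exact hmul d' h' d h
      · exact hSo' d h d' h' hne

/-! ### Polynomials in one element -/

/-- The value at `x` of a polynomial. -/
def polyEval (x : E) (p : Polynomial ℝ) : E := Polynomial.aeval (L x : Module.End ℝ E) p one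

/-- `L_mul_L_mul_L` expresses `L (x^(n+2))` through `L x`, `L (x²)`, `L (x^n)` and `L (x^(n+1))`,
which all commute with `L x`. -/
theorem commute_L_L_pow (x : E) (n : ℕ) :
    Commute (L x : Module.End ℝ E) (L (((L x : Module.End ℝ E) ^ n) one)) := by
  induction n using Nat.twoStepInduction with
  | zero => rw [pow_zero, Module.End.one_apply, L_one]; exact Commute.one_right _
  | one => rw [pow_one, mul_one]
  | more n ih₀ ih₁ =>
    set u := ((L x : Module.End ℝ E) ^ n) one with hu
    have e₁ : ((L x : Module.End ℝ E) ^ (n + 1)) one = L x u := by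
      rw [pow_succ', Module.End.mul_apply]
    have e₂ : ((L x : Module.End ℝ E) ^ (n + 2)) one = L x (L x u) := by
      rw [pow_succ', Module.End.mul_apply, e₁]
    rw [e₁] at ih₁
    rw [e₂]
    have h := L_mul_L_mul_L x x u
    rw [mul_comm u x, mul_comm (L x u) x] at h
    rw [eq_sub_of_add_eq' h]
    have hx := Commute.refl (L x : Module.End ℝ E)
    exact ((((commute_L_L_sq x).mul_right ih₀).add_right (ih₁.mul_right hx)).add_right
      (ih₁.mul_right hx)).sub_right
        (((hx.mul_right hx).mul_right ih₀).add_right ((ih₀.mul_right hx).mul_right hx))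

theorem commute_L_polyEval (x : E) (p : Polynomial ℝ) :
    Commute (L x : Module.End ℝ E) (L (polyEval x p)) := by
  induction p using Polynomial.induction_on' with
  | add p q hp hq =>
    have : polyEval x (p + q) = polyEval x p + polyEval x q := by simp [polyEval]
    rw [this, map_add]; exact hp.add_right hq
  | monomial n a =>
    have : polyEval x (Polynomial.monomial n a) = a • ((L x : Module.End ℝ E) ^ n) one := by
      simp [polyEval, Polynomial.aeval_monomial, Module.End.mul_apply]
    rw [this, map_smul]; exact (commute_L_L_pow x n).smul_right a

theorem polyEval_mul (x : E) (p q : Polynomial ℝ) :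
    L (polyEval x p) (polyEval x q) = polyEval x (p * q) := by
  have h : Commute (Polynomial.aeval (L x : Module.End ℝ E) q) (L (polyEval x p)) := by
    induction q using Polynomial.induction_on' with
    | add q₁ q₂ h₁ h₂ => rw [map_add]; exact h₁.add_left h₂
    | monomial n a =>
      rw [Polynomial.aeval_monomial]
      exact (Algebra.commute_algebraMap_left a _).mul_left ((commute_L_polyEval x p).pow_left n)
  have := LinearMap.congr_fun h.eq one
  simp only [Module.End.mul_apply, mul_one] at this
  change L (polyEval x p) (Polynomial.aeval (L x : Module.End ℝ E) q one) = _
  rw [← this, _root_.mul_comm p q, polyEval, polyEval, map_mul, Module.End.mul_apply]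

theorem polyEval_one (x : E) : polyEval x 1 = one := by simp [polyEval]

theorem polyEval_X (x : E) : polyEval x Polynomial.X = x := by simp [polyEval, mul_one]

theorem polyEval_eq_of_eigenvalues (x : E) {p q : Polynomial ℝ}
    (h : ∀ t, Module.End.HasEigenvalue (L x : Module.End ℝ E) t → p.eval t = q.eval t) :
    polyEval x p = polyEval x q := by
  refine LinearMap.congr_fun (f := Polynomial.aeval (L x : Module.End ℝ E) p)
    (g := Polynomial.aeval (L x : Module.End ℝ E) q) ?_ one
  refine ((L_isSymmetric x).eigenvectorBasis rfl).toBasis.ext fun i => ?_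
  have hi := (L_isSymmetric x).hasEigenvector_eigenvectorBasis rfl i
  rw [OrthonormalBasis.coe_toBasis, Module.End.aeval_apply_of_hasEigenvector hi,
    Module.End.aeval_apply_of_hasEigenvector hi,
    h _ ((L_isSymmetric x).hasEigenvalue_eigenvalues rfl i)]

/-! ### Complete systems of orthogonal idempotents -/

/-- A family of pairwise orthogonal idempotents with sum `one`. -/
structure IsCompleteSystem {ι : Type*} [Fintype ι] (c : ι → E) : Prop where
  idem : ∀ i, IsIdempotent (c i)
  orthogonal : ∀ i j, i ≠ j → L (c i) (c j) = 0
  sum_eq_one : ∑ i, c i = one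

section CompleteSystem

variable {ι : Type*} [Fintype ι] {c : ι → E}

theorem IsCompleteSystem.mul_sum (hc : IsCompleteSystem c) (i : ι) (g : ι → ℝ) :
    L (c i) (∑ j, g j • c j) = g i • c i := by
  rw [map_sum, Finset.sum_eq_single i]
  · rw [map_smul, hc.idem i]
  · intro j _ hj
    rw [map_smul, hc.orthogonal i j hj.symm, smul_zero]
  · simp

theorem IsCompleteSystem.sum_mul_sum (hc : IsCompleteSystem c) (f g : ι → ℝ) :
    L (∑ i, f i • c i) (∑ i, g i • c i) = ∑ i, (f i * g i) • c i := by
  rw [map_sum L, LinearMap.sum_apply]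
  refine Finset.sum_congr rfl fun i _ => ?_
  rw [map_smul, LinearMap.smul_apply, hc.mul_sum, smul_smul]

theorem IsCompleteSystem.P_sum (hc : IsCompleteSystem c) (f g : ι → ℝ) :
    P (∑ i, f i • c i) (∑ i, g i • c i) = ∑ i, (f i ^ 2 * g i) • c i := by
  rw [P_apply, hc.sum_mul_sum, hc.sum_mul_sum, hc.sum_mul_sum, hc.sum_mul_sum, Finset.smul_sum,
    ← Finset.sum_sub_distrib]
  refine Finset.sum_congr rfl fun i _ => ?_
  module

theorem IsCompleteSystem.inner_sum_right (hc : IsCompleteSystem c) (i : ι) (g : ι → ℝ) :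
    inner ℝ (c i) (∑ j, g j • c j) = g i * ‖c i‖ ^ 2 := by
  have h := hc.mul_sum i g
  rw [← hc.idem i, ← inner_mul, h, inner_smul_right, real_inner_self_eq_norm_sq, hc.idem i]

theorem IsCompleteSystem.polyEval_sum (hc : IsCompleteSystem c) (f : ι → ℝ)
    (p : Polynomial ℝ) : polyEval (∑ i, f i • c i) p = ∑ i, p.eval (f i) • c i := by
  induction p using Polynomial.induction_on' with
  | add p q hp hq =>
    have : ∀ x : E, polyEval x (p + q) = polyEval x p + polyEval x q := by simp [polyEval]
    simp only [this, hp, hq, Polynomial.eval_add, add_smul, Finset.sum_add_distrib]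
  | monomial n a =>
    have : ∀ x : E, polyEval x (Polynomial.monomial n a) =
        a • ((L x : Module.End ℝ E) ^ n) one := by
      simp [polyEval, Polynomial.aeval_monomial, Module.End.mul_apply]
    rw [this]
    clear this
    have hpow : ((L (∑ i, f i • c i) : Module.End ℝ E) ^ n) one = ∑ i, f i ^ n • c i := by
      induction n with
      | zero => simp [hc.sum_eq_one]
      | succ n ih =>
        rw [pow_succ', Module.End.mul_apply, ih, hc.sum_mul_sum]
        simp only [pow_succ']
    rw [hpow, Finset.smul_sum]
    simp [smul_smul]

/-- The functional calculus does not depend on the decomposition. -/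
theorem IsCompleteSystem.sum_apply_smul_eq (hc : IsCompleteSystem c) {κ : Type*} [Fintype κ]
    {d : κ → E} (hd : IsCompleteSystem d) {f : ι → ℝ} {g : κ → ℝ}
    (h : ∑ i, f i • c i = ∑ j, g j • d j) (φ : ℝ → ℝ) :
    ∑ i, φ (f i) • c i = ∑ j, φ (g j) • d j := by
  classical
  -- One polynomial interpolates `φ` at the eigenvalues of both decompositions, and polynomial
  -- values depend on the element alone.
  set s : Finset ℝ := Finset.univ.image f ∪ Finset.univ.image g
  have hp : ∀ t ∈ s, (Lagrange.interpolate s id φ).eval t = φ t := fun t ht =>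
    Lagrange.eval_interpolate_at_node φ Function.injective_id.injOn ht
  have h₁ := hc.polyEval_sum f (Lagrange.interpolate s id φ)
  rw [h, hd.polyEval_sum] at h₁
  have hf : ∀ i, f i ∈ s := fun i => by simp [s]
  have hg : ∀ j, g j ∈ s := fun j => by simp [s]
  simpa only [hp _ (hf _), hp _ (hg _)] using h₁.symm

end CompleteSystem

theorem SpectralDecomposition.isCompleteSystem {x : E} (s : SpectralDecomposition x) :
    IsCompleteSystem s.idem :=
  ⟨fun i => (s.primitive i).1, s.orthogonal, s.sum_idem⟩

/-- The idempotents are the Lagrange basis polynomials of the spectrum of `L x`, evaluated at `x`.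
That spectrum also contains half sums of eigenvalues of `x`, so some of the idempotents may be zero.
-/
theorem exists_isCompleteSystem (x : E) : ∃ (t : Finset ℝ) (c : t → E),
    IsCompleteSystem c ∧ x = ∑ i : t, (i : ℝ) • c i := by
  classical
  set t : Finset ℝ := Finset.univ.image ((L_isSymmetric x).eigenvalues rfl)
  have ht : ∀ s, Module.End.HasEigenvalue (L x : Module.End ℝ E) s → s ∈ t := by
    intro s hs
    obtain ⟨i, hi⟩ := (L_isSymmetric x).exists_eigenvalues_eq rfl hs
    exact Finset.mem_image.2 ⟨i, Finset.mem_univ _, hi⟩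
  have heval : ∀ i ∈ t, ∀ j ∈ t, (Lagrange.basis t id i).eval j = if i = j then 1 else 0 := by
    intro i hi j hj
    split_ifs with h
    · rw [← h]; exact Lagrange.eval_basis_self Function.injective_id.injOn hi
    · exact Lagrange.eval_basis_of_ne (v := id) h hj
  have hsum : ∀ f : t → ℝ, ∑ i, f i • polyEval x (Lagrange.basis t id (i : ℝ)) =
      polyEval x (∑ i, f i • Lagrange.basis t id (i : ℝ)) := fun f => by
    simp [polyEval, map_sum, map_smul]
  refine ⟨t, fun i => polyEval x (Lagrange.basis t id (i : ℝ)),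
    ⟨fun i => ?_, fun i j hij => ?_, ?_⟩, ?_⟩
  · rw [IsIdempotent, polyEval_mul]
    refine polyEval_eq_of_eigenvalues x fun s hs => ?_
    rw [Polynomial.eval_mul, heval i i.2 s (ht s hs)]
    split_ifs <;> simp
  · rw [polyEval_mul]
    have : (0 : E) = polyEval x 0 := by simp [polyEval]
    rw [this]
    refine polyEval_eq_of_eigenvalues x fun s hs => ?_
    rw [Polynomial.eval_mul, heval i i.2 s (ht s hs), heval j j.2 s (ht s hs)]
    have := fun h => hij (Subtype.ext h)
    split_ifs with h₁ h₂ <;> simp_all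
  · have h := hsum 1
    simp only [Pi.one_apply, one_smul] at h
    rw [h, ← polyEval_one x]
    refine polyEval_eq_of_eigenvalues x fun s hs => ?_
    rw [Polynomial.eval_finsetSum, Finset.sum_coe_sort t (fun i => (Lagrange.basis t id i).eval s)]
    rw [Finset.sum_congr rfl fun i hi => heval i hi s (ht s hs)]
    simp [ht s hs]
  · rw [hsum]
    nth_rewrite 1 [← polyEval_X x]
    refine polyEval_eq_of_eigenvalues x fun s hs => ?_
    rw [Polynomial.eval_finsetSum,
      Finset.sum_coe_sort t (fun i => (i • Lagrange.basis t id i).eval s)]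
    simp only [Polynomial.eval_smul]
    rw [Finset.sum_congr rfl fun i hi => by rw [heval i hi s (ht s hs)]]
    simp [ht s hs]

/-- The spectral theorem. -/
theorem nonempty_spectralDecomposition (x : E) : Nonempty (SpectralDecomposition x) := by
  classical
  obtain ⟨t, c, hc, hx⟩ := exists_isCompleteSystem x
  choose S hS hSo hSs using fun i => exists_primitive_decomposition (hc.idem i)
  -- The inner products of the pieces of `c i` and `c j` are nonnegative with sum `⟨c i, c j⟩ = 0`.
  have hort : ∀ i j : t, i ≠ j → ∀ d ∈ S i, ∀ d' ∈ S j, L d d' = 0 := by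
    intro i j hij d hd d' hd'
    rw [(hS i d hd).1.mul_eq_zero_iff (hS j d' hd').1]
    have h₀ := ((hc.idem i).mul_eq_zero_iff (hc.idem j)).1 (hc.orthogonal i j hij)
    refine le_antisymm ?_ ((hS i d hd).1.inner_nonneg (hS j d' hd').1)
    rw [← h₀, ← hSs i, ← hSs j, sum_inner]
    refine le_trans ?_ (Finset.single_le_sum (f := fun d => inner ℝ d (∑ d' ∈ S j, d'))
      (fun u hu => ?_) hd)
    · rw [inner_sum]
      exact Finset.single_le_sum (f := fun d' => inner ℝ d d')
        (fun u hu => (hS i d hd).1.inner_nonneg (hS j u hu).1) hd'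
    · rw [inner_sum]
      exact Finset.sum_nonneg fun v hv => (hS i u hu).1.inner_nonneg (hS j v hv).1
  let ι := Σ i : t, S i
  let e : ι ≃ Fin (Fintype.card ι) := Fintype.equivFin ι
  refine ⟨⟨Fintype.card ι, fun k => (e.symm k).2, fun k => (e.symm k).1,
    fun k => hS _ _ (e.symm k).2.2,
    fun k l hkl => ?_, ?_, ?_⟩⟩
  · have hne : e.symm k ≠ e.symm l := fun h => hkl (e.symm.injective h)
    generalize e.symm k = p at hne ⊢
    generalize e.symm l = q at hne ⊢
    obtain ⟨i, d, hd⟩ := p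
    obtain ⟨j, d', hd'⟩ := q
    by_cases hij : i = j
    · subst hij
      refine hSo i d hd d' hd' fun h => hne ?_
      subst h; rfl
    · exact hort i j hij d hd d' hd'
  · rw [Equiv.sum_comp e.symm (fun p : ι => (p.2 : E)), Fintype.sum_sigma, ← hc.sum_eq_one]
    exact Finset.sum_congr rfl fun i _ => by rw [← hSs i, Finset.sum_coe_sort (S i) (fun d => d)]
  · rw [Equiv.sum_comp e.symm (fun p : ι => ((p.1 : ℝ) • (p.2 : E))), Fintype.sum_sigma, hx]
    refine Finset.sum_congr rfl fun i _ => ?_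
    rw [← hSs i, Finset.smul_sum, Finset.sum_coe_sort (S i) (fun d => (i : ℝ) • d)]

/-! ### The trace of the multiplication operators -/

/-- The trace of multiplication by `x`. -/
def traceL (x : E) : ℝ := LinearMap.trace ℝ E (L x)

theorem traceL_smul (t : ℝ) (x : E) : traceL (t • x) = t * traceL x := by
  rw [traceL, map_smul, map_smul, smul_eq_mul, traceL]

/-- The two specializations of `L_mul_L_mul_L` contain the same operator products up to cyclic
order, so under the trace only these terms differ. -/
theorem traceL_mul_mul (x y : E) : traceL (L x (L x y)) = traceL (L (L x x) y) := by
  have h₁ := congrArg (LinearMap.trace ℝ E) (L_mul_L_mul_L x x y)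
  have h₂ := congrArg (LinearMap.trace ℝ E) (L_mul_L_mul_L x y x)
  have e₁ := LinearMap.trace_mul_cycle ℝ (L x : Module.End ℝ E) (L x) (L y)
  have e₂ := LinearMap.trace_mul_cycle ℝ (L x : Module.End ℝ E) (L y) (L x)
  rw [mul_comm y x, mul_comm (L x y) x] at h₁
  simp only [map_add] at h₁ h₂
  unfold traceL
  linarith

theorem traceL_P {c : E} (hc : IsIdempotent c) (y : E) : traceL (P c y) = traceL (L c y) := by
  have h := traceL_mul_mul c y
  rw [P_apply, traceL, map_sub, map_smul, map_sub, map_smul]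
  rw [hc, traceL, traceL] at h
  rw [hc, h, traceL, smul_eq_mul]
  ring

theorem IsIdempotent.traceL_pos {c : E} (hc : IsIdempotent c) (h₀ : c ≠ 0) : 0 < traceL c := by
  have b := stdOrthonormalBasis ℝ E
  rw [traceL, LinearMap.trace_eq_sum_inner _ b]
  have hnn : ∀ i ∈ Finset.univ, 0 ≤ inner ℝ (b i) (L c (b i)) := fun i _ => by
    rw [real_inner_comm]; exact hc.inner_mul_self_nonneg _
  refine (Finset.sum_nonneg hnn).lt_of_ne fun h => h₀ ?_
  have h' := (Finset.sum_eq_zero_iff_of_nonneg hnn).1 h.symm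
  have hL : (L c : Module.End ℝ E) = 0 := b.toBasis.ext fun i => by
    have hi := h' i (Finset.mem_univ i)
    rw [real_inner_comm] at hi
    simpa using hc.mul_eq_zero_of_inner_eq_zero hi
  rw [← mul_one c, hL, LinearMap.zero_apply]

/-! ### Primitive idempotents -/

theorem IsPrimitiveIdempotent.eq_smul_of_mul_eq {c y : E} (hc : IsPrimitiveIdempotent c)
    (hy : L c y = y) : ∃ t : ℝ, y = t • c := by
  obtain ⟨s⟩ := nonempty_spectralDecomposition y
  have hs := s.isCompleteSystem
  -- This is `⟨e - c, y²⟩ = ⟨(e - c) y, y⟩ = 0`. Its terms are nonnegative, so every idempotent with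
  -- a nonzero eigenvalue lies below `c`, hence equals `c` by primitivity.
  have hsum : ∑ i, s.eigenvalue i ^ 2 * inner ℝ (one - c) (s.idem i) = 0 := by
    have h : inner ℝ (one - c) (L y y) = 0 := by
      rw [inner_mul, map_sub, LinearMap.sub_apply, one_mul, hy, sub_self, inner_zero_left]
    have hyy : L y y = ∑ i, (s.eigenvalue i * s.eigenvalue i) • s.idem i := by
      conv_lhs => rw [s.sum_eq]
      exact hs.sum_mul_sum _ _
    rw [hyy, inner_sum] at h
    simpa only [inner_smul_right, ← sq] using h
  have h1c : IsIdempotent (one - c) := isIdempotent_one.sub hc.1 (one_mul c)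
  have hz := (Finset.sum_eq_zero_iff_of_nonneg fun i _ =>
    mul_nonneg (sq_nonneg (s.eigenvalue i)) (h1c.inner_nonneg (hs.idem i))).1 hsum
  have key : ∀ i, s.eigenvalue i ≠ 0 → s.idem i = c := by
    intro i hi
    have h₁ : inner ℝ (one - c) (s.idem i) = 0 :=
      (mul_eq_zero.1 (hz i (Finset.mem_univ i))).resolve_left (pow_ne_zero 2 hi)
    have h₂ := (h1c.mul_eq_zero_iff (hs.idem i)).2 h₁
    rw [map_sub, LinearMap.sub_apply, one_mul, sub_eq_zero] at h₂
    by_contra hne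
    exact hc.2.2 ⟨s.idem i, c - s.idem i, hs.idem i, (s.primitive i).2.1,
      hc.1.sub (hs.idem i) h₂.symm, sub_ne_zero.2 (Ne.symm hne), by abel⟩
  refine ⟨∑ i, s.eigenvalue i, ?_⟩
  rw [Finset.sum_smul]
  nth_rewrite 1 [s.sum_eq]
  refine Finset.sum_congr rfl fun i _ => ?_
  by_cases hi : s.eigenvalue i = 0
  · simp [hi]
  · rw [key i hi]

theorem IsPrimitiveIdempotent.P_apply_eq {c : E} (hc : IsPrimitiveIdempotent c) (d : E) :
    P c d = (inner ℝ c d / ‖c‖ ^ 2) • c := by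
  have hL : L c (P c d) = P c d := by
    have h := hc.1.L_cubic d
    rw [P_apply, hc.1, map_sub, map_smul, h]
    module
  obtain ⟨t, ht⟩ := hc.eq_smul_of_mul_eq hL
  have hcc : P c c = c := by
    rw [P_apply, hc.1, hc.1]; module
  have h : t * ‖c‖ ^ 2 = inner ℝ c d := by
    rw [← real_inner_self_eq_norm_sq, ← inner_smul_right, ← ht, ← P_isSymmetric c, hcc]
  have : ‖c‖ ≠ 0 := norm_ne_zero_iff.2 hc.2.1
  rw [ht, ← h]
  field_simp

/-- With `P c d = t c` and `P d c = u d`, the fundamental formula applied to `c` gives `t² = t u`,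
so `t = u ≠ 0`. Then `t tr L(c) = tr L(c d) = u tr L(d)` by `traceL_P`. -/
theorem IsPrimitiveIdempotent.traceL_eq {c d : E} (hc : IsPrimitiveIdempotent c)
    (hd : IsPrimitiveIdempotent d) (h : L c d ≠ 0) : traceL c = traceL d := by
  have hin : inner ℝ c d ≠ 0 := fun h' => h ((hc.1.mul_eq_zero_iff hd.1).2 h')
  have hnc : ‖c‖ ≠ 0 := norm_ne_zero_iff.2 hc.2.1
  have hcc : P c c = c := by rw [P_apply, hc.1, hc.1]; module
  set t := inner ℝ c d / ‖c‖ ^ 2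
  set u := inner ℝ c d / ‖d‖ ^ 2
  have h₁ : P c d = t • c := hc.P_apply_eq d
  have h₂ : P d c = u • d := by rw [hd.P_apply_eq c, real_inner_comm]
  have ht₀ : t ≠ 0 := div_ne_zero hin (pow_ne_zero 2 hnc)
  have hff := LinearMap.congr_fun (P_P d c) c
  have hsm : P (t • c) c = (t * t) • c := by
    have hc' : L c c = c := hc.1
    simp only [P_apply, map_smul, LinearMap.smul_apply, hc']
    module
  rw [h₁, hsm, Module.End.mul_apply, Module.End.mul_apply, hcc, h₂, map_smul, h₁, smul_smul] at hff
  have htu : t = u := mul_right_cancel₀ ht₀ (smul_left_injective ℝ hc.2.1 hff)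
  have e₁ := traceL_P hc.1 d
  have e₂ := traceL_P hd.1 c
  rw [h₁, traceL_smul] at e₁
  rw [h₂, traceL_smul, mul_comm d c, ← e₁, ← htu] at e₂
  exact (mul_left_cancel₀ ht₀ e₂).symm

/-! ### The determinant of the quadratic representation -/

theorem P_one : P (one : E) = 1 := by
  ext y
  rw [P_apply, one_mul, one_mul, one_mul, one_mul, Module.End.one_apply]
  module

/-- On the Peirce space of `c` with eigenvalue `0`, `1/2` or `1`, the operator is multiplication by
`1`, `t` or `t²`, that is by `t` to twice the eigenvalue. -/
theorem IsIdempotent.det_P_ne_zero_and_log {c : E} (hc : IsIdempotent c) {t : ℝ} (ht : t ≠ 0) :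
    LinearMap.det (P (one + (t - 1) • c)) ≠ 0 ∧
      Real.log (LinearMap.det (P (one + (t - 1) • c))) = 2 * traceL c * Real.log t := by
  set b := ((L_isSymmetric c).eigenvectorBasis rfl)
  set l := ((L_isSymmetric c).eigenvalues rfl)
  have hb : ∀ i, L c (b i) = l i • b i := fun i => (L_isSymmetric c).apply_eigenvectorBasis rfl i
  have hl : ∀ i, l i = 0 ∨ l i = 1 / 2 ∨ l i = 1 := by
    intro i
    have h := hc.L_cubic (b i)
    simp only [hb, map_smul, smul_smul, ← sub_smul] at h
    have h' := smul_left_injective ℝ (b.toBasis.ne_zero i) (by simpa using h)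
    have : l i * ((l i - 1 / 2) * (l i - 1)) = 0 := by linarith
    simpa [sub_eq_zero] using this
  have hP : ∀ i, P (one + (t - 1) • c) (b i) =
      (1 + 4 * (t - 1) * l i + 2 * (t - 1) ^ 2 * l i ^ 2 - (t ^ 2 - 1) * l i) • b i := by
    intro i
    have hc' : L c c = c := hc
    simp only [P_apply, map_add, map_smul, LinearMap.add_apply, LinearMap.smul_apply, one_mul,
      mul_one, hb, hc']
    module
  have hm : ∀ i, (1 + 4 * (t - 1) * l i + 2 * (t - 1) ^ 2 * l i ^ 2 - (t ^ 2 - 1) * l i) ≠ 0 ∧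
      Real.log (1 + 4 * (t - 1) * l i + 2 * (t - 1) ^ 2 * l i ^ 2 - (t ^ 2 - 1) * l i) =
        2 * l i * Real.log t := by
    intro i
    rcases hl i with h | h | h <;> rw [h]
    · norm_num
    · have : 1 + 4 * (t - 1) * (1 / 2) + 2 * (t - 1) ^ 2 * (1 / 2) ^ 2 - (t ^ 2 - 1) * (1 / 2) =
          t := by
        ring
      rw [this]; exact ⟨ht, by ring⟩
    · have : 1 + 4 * (t - 1) * 1 + 2 * (t - 1) ^ 2 * 1 ^ 2 - (t ^ 2 - 1) * 1 = t ^ 2 := by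
        ring
      rw [this, Real.log_pow]; exact ⟨pow_ne_zero 2 ht, by push_cast; ring⟩
  rw [det_eq_prod_of_basis b.toBasis (by simpa using hP), traceL,
    trace_eq_sum_of_basis b.toBasis (by simpa using hb)]
  refine ⟨Finset.prod_ne_zero_iff.2 fun i _ => (hm i).1, ?_⟩
  rw [Real.log_prod fun i _ => (hm i).1, Finset.mul_sum, Finset.sum_mul]
  exact Finset.sum_congr rfl fun i _ => (hm i).2

theorem det_P_P (x y : E) :
    LinearMap.det (P (P y x)) = LinearMap.det (P y) ^ 2 * LinearMap.det (P x) := by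
  rw [P_P, map_mul, map_mul]; ring

section CompleteSystem

variable {ι : Type*} [Fintype ι] {c : ι → E}

/-- The coefficients are switched on one at a time: applying `P(e + (√fᵢ - 1) cᵢ)` changes the
`i`-th from `1` to `fᵢ`, and `det_P_P` records the effect. -/
theorem IsCompleteSystem.log_det_P_of_pos (hc : IsCompleteSystem c) {f : ι → ℝ}
    (hf : ∀ i, 0 < f i) : LinearMap.det (P (∑ i, f i • c i)) ≠ 0 ∧
      Real.log (LinearMap.det (P (∑ i, f i • c i))) =
        ∑ i, 2 * traceL (c i) * Real.log (f i) := by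
  classical
  have key : ∀ S : Finset ι,
      LinearMap.det (P (∑ i, (if i ∈ S then f i else 1) • c i)) ≠ 0 ∧
      Real.log (LinearMap.det (P (∑ i, (if i ∈ S then f i else 1) • c i))) =
        ∑ i ∈ S, 2 * traceL (c i) * Real.log (f i) := by
    intro S
    induction S using Finset.induction_on with
    | empty =>
      simp [hc.sum_eq_one, P_one]
    | insert i S hi ih =>
      have hsq : √(f i) ≠ 0 := (Real.sqrt_pos.2 (hf i)).ne'
      have hu : one + (√(f i) - 1) • c i = ∑ j, (if j = i then √(f i) else 1) • c j := by
        rw [← hc.sum_eq_one, eq_comm, ← sub_eq_iff_eq_add', ← Finset.sum_sub_distrib,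
          Finset.sum_eq_single i]
        · simp [sub_smul]
        · intro j _ hj; simp [hj]
        · simp
      have hPu : ∑ j, (if j ∈ insert i S then f j else 1) • c j =
          P (one + (√(f i) - 1) • c i) (∑ j, (if j ∈ S then f j else 1) • c j) := by
        rw [hu, hc.P_sum]
        refine Finset.sum_congr rfl fun j _ => ?_
        by_cases hj : j = i
        · subst hj
          simp [hi, Real.sq_sqrt (hf j).le]
        · simp [hj]
      obtain ⟨h₁, h₂⟩ := (hc.idem i).det_P_ne_zero_and_log hsq
      rw [hPu, det_P_P]
      refine ⟨mul_ne_zero (pow_ne_zero 2 h₁) ih.1, ?_⟩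
      rw [Real.log_mul (pow_ne_zero 2 h₁) ih.1, Real.log_pow, h₂, ih.2, Finset.sum_insert hi,
        Real.log_sqrt (hf i).le]
      push_cast; ring
  simpa using key Finset.univ

/-- Signs are allowed so that `P(z^(-1/2)) x` can be treated knowing only that it is invertible;
`Real.log` ignores the sign. -/
theorem IsCompleteSystem.log_det_P (hc : IsCompleteSystem c) {f : ι → ℝ}
    (hf : ∀ i, f i ≠ 0) : LinearMap.det (P (∑ i, f i • c i)) ≠ 0 ∧
      Real.log (LinearMap.det (P (∑ i, f i • c i))) =
        ∑ i, 2 * traceL (c i) * Real.log (f i) := by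
  -- `x = P(u) v` with `u > 0` and `v² = one`
  have hx : ∑ i, f i • c i =
      P (∑ i, √|f i| • c i) (∑ i, (f i / |f i|) • c i) := by
    rw [hc.P_sum]
    refine Finset.sum_congr rfl fun i _ => ?_
    rw [Real.sq_sqrt (abs_nonneg _), mul_div_cancel₀ _ (abs_ne_zero.2 (hf i))]
  have hv : LinearMap.det (P (∑ i, (f i / |f i|) • c i)) ^ 2 = 1 := by
    have h := det_P_P (one : E) (∑ i, (f i / |f i|) • c i)
    have hone : P (∑ i, (f i / |f i|) • c i) one = one := by
      have : (one : E) = ∑ i, (1 : ℝ) • c i := by simp [hc.sum_eq_one]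
      rw [this, hc.P_sum]
      refine Finset.sum_congr rfl fun i _ => ?_
      rw [div_pow, sq_abs, div_self (pow_ne_zero 2 (hf i)), _root_.mul_one]
    rw [hone, P_one, map_one, _root_.mul_one] at h
    exact h.symm
  have hv₀ : LinearMap.det (P (∑ i, (f i / |f i|) • c i)) ≠ 0 := by
    intro h; rw [h] at hv; norm_num at hv
  have hvl : Real.log (LinearMap.det (P (∑ i, (f i / |f i|) • c i))) = 0 := by
    rcases mul_self_eq_one_iff.1 (sq (LinearMap.det (P (∑ i, (f i / |f i|) • c i))) ▸ hv)
      with h | h <;> simp [h]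
  obtain ⟨h₁, h₂⟩ := hc.log_det_P_of_pos (f := fun i => √|f i|)
    fun i => Real.sqrt_pos.2 (abs_pos.2 (hf i))
  rw [hx, det_P_P]
  refine ⟨mul_ne_zero (pow_ne_zero 2 h₁) hv₀, ?_⟩
  rw [Real.log_mul (pow_ne_zero 2 h₁) hv₀, hvl, Real.log_pow, h₂, add_zero, Finset.mul_sum]
  refine Finset.sum_congr rfl fun i _ => ?_
  rw [Real.log_sqrt (abs_nonneg _), Real.log_abs]
  push_cast; ring

theorem IsCompleteSystem.ne_zero_of_det_P_ne_zero (hc : IsCompleteSystem c) {f : ι → ℝ}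
    (h : LinearMap.det (P (∑ i, f i • c i)) ≠ 0) (i : ι) (hi : c i ≠ 0) : f i ≠ 0 := by
  classical
  intro h₀
  have hz : P (∑ i, f i • c i) (c i) = 0 := by
    have : c i = ∑ j, (if j = i then (1 : ℝ) else 0) • c j := by simp
    rw [this, hc.P_sum]
    refine Finset.sum_eq_zero fun j _ => ?_
    by_cases hj : j = i
    · simp [hj, h₀]
    · simp [hj]
  have hinj := (LinearMap.equivOfDetNeZero _ h).injective
  exact hi (hinj (by simpa using hz))

end CompleteSystem

/-! ### The decomposition by the trace, and the logarithm of the determinant -/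

variable (E) in
/-- A fixed complete system of primitive orthogonal idempotents. -/
def referenceFrame : SpectralDecomposition (one : E) := (nonempty_spectralDecomposition one).some

variable (E) in
/-- The values of `traceL` on primitive idempotents. -/
def traceValues : Finset ℝ := Finset.univ.image fun i => traceL ((referenceFrame E).idem i)

variable (E) in
open Classical in
/-- The central idempotent that is the unit of the sum of the ideals on whose primitive idempotents
`traceL` has the value `ν`. -/
def centralIdem (ν : ℝ) : E :=
  ∑ i, if traceL ((referenceFrame E).idem i) = ν then (referenceFrame E).idem i else 0

open Classical in
-- Primitive idempotents with different traces have product zero by `traceL_eq`, so only the frame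
-- members sharing the trace of `d` act on it.
theorem centralIdem_mul_primitive (ν : ℝ) {d : E} (hd : IsPrimitiveIdempotent d) :
    L (centralIdem E ν) d = if traceL d = ν then d else 0 := by
  set s := referenceFrame E
  have h₀ : ∀ i, traceL (s.idem i) ≠ traceL d → L (s.idem i) d = 0 := fun i hi => by
    by_contra h; exact hi ((s.primitive i).traceL_eq hd h)
  rw [centralIdem, map_sum, LinearMap.sum_apply]
  split_ifs with h
  · have hsum : d = ∑ i, L (s.idem i) d := by
      rw [← LinearMap.sum_apply, ← map_sum, s.sum_idem, one_mul]
    conv_rhs => rw [hsum]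
    refine Finset.sum_congr rfl fun i _ => ?_
    split_ifs with h'
    · rfl
    · rw [h₀ i (h ▸ h'), map_zero, LinearMap.zero_apply]
  · refine Finset.sum_eq_zero fun i _ => ?_
    split_ifs with h'
    · exact h₀ i fun h'' => h (h'' ▸ h')
    · rw [map_zero, LinearMap.zero_apply]

theorem IsPrimitiveIdempotent.traceL_mem {d : E} (hd : IsPrimitiveIdempotent d) :
    traceL d ∈ traceValues E := by
  set s := referenceFrame E
  by_contra h
  have h₀ : ∀ i, L (s.idem i) d = 0 := fun i => by
    by_contra h'
    exact h (Finset.mem_image.2 ⟨i, Finset.mem_univ i, (s.primitive i).traceL_eq hd h'⟩)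
  apply hd.2.1
  rw [← one_mul d, ← s.sum_idem, map_sum, LinearMap.sum_apply]
  exact Finset.sum_eq_zero fun i _ => h₀ i

theorem primitive_induction {p : E → Prop} (h : ∀ d, IsPrimitiveIdempotent d → p d)
    (h_zero : p 0) (h_add : ∀ x y, p x → p y → p (x + y)) (h_smul : ∀ (t : ℝ) x, p x → p (t • x))
    (x : E) : p x := by
  obtain ⟨s⟩ := nonempty_spectralDecomposition x
  rw [s.sum_eq]
  exact Finset.sum_induction _ p h_add h_zero fun i _ => h_smul _ _ (h _ (s.primitive i))

/-- Tested on primitive `d`, `f`: with equal traces both sides carry the same factor, and otherwise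
`⟨d y, f⟩ = ⟨y, d f⟩ = 0`. -/
theorem centralIdem_mul_mul (ν : ℝ) (x y : E) :
    L (centralIdem E ν) (L x y) = L (L (centralIdem E ν) x) y := by
  classical
  refine ext_inner_right ℝ fun z => ?_
  revert z x
  refine primitive_induction (fun d hd => ?_) ?_ ?_ ?_
  · refine primitive_induction (fun f hf => ?_) ?_ ?_ ?_
    · rw [L_isSymmetric, centralIdem_mul_primitive ν hd, centralIdem_mul_primitive ν hf]
      by_cases h : traceL d = traceL f
      · rw [h]; split_ifs <;> simp
      · have h₀ : inner ℝ (L d y) f = 0 := by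
          have : L d f = 0 := by
            by_contra h'; exact h (hd.traceL_eq hf h')
          rw [L_isSymmetric, this, inner_zero_right]
        split_ifs <;> simp [h₀]
    · simp only [inner_zero_right]
    · intro z z' h h'; rw [inner_add_right, inner_add_right, h, h']
    · intro t z h; rw [inner_smul_right, inner_smul_right, h]
  · simp
  · intro z z' h h' w
    simp only [map_add, LinearMap.add_apply, inner_add_left, h, h']
  · intro t z h w
    simp only [map_smul, LinearMap.smul_apply, inner_smul_left, h]

theorem centralIdem_mul_centralIdem_mul (ν : ℝ) (x : E) :
    L (centralIdem E ν) (L (centralIdem E ν) x) = L (centralIdem E ν) x := by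
  classical
  revert x
  refine primitive_induction (fun d hd => ?_) ?_ ?_ ?_
  · rw [centralIdem_mul_primitive ν hd]
    split_ifs with h
    · rw [centralIdem_mul_primitive ν hd, if_pos h]
    · rw [map_zero]
  · simp
  · intro x y hx hy; simp only [map_add, hx, hy]
  · intro t x hx; simp only [map_smul, hx]

/-- The element with the component of `x` along `centralIdem E ν` and the other components of
`one`. -/
def component (ν : ℝ) (x : E) : E := L (centralIdem E ν) x + (one - centralIdem E ν)

theorem component_mul (ν : ℝ) (x y : E) :
    L (component ν x) (component ν y) = component ν (L x y) := by
  have h₁ : ∀ u : E, L (L (centralIdem E ν) u) (centralIdem E ν) = L (centralIdem E ν) u :=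
    fun u => by rw [mul_comm, centralIdem_mul_centralIdem_mul]
  have h₂ : L (centralIdem E ν) (centralIdem E ν) = centralIdem E ν := by
    have := h₁ one
    rwa [mul_one] at this
  have h₃ : L (L (centralIdem E ν) x) (L (centralIdem E ν) y) = L (centralIdem E ν) (L x y) := by
    rw [← centralIdem_mul_mul, mul_comm x, ← centralIdem_mul_mul, mul_comm y,
      centralIdem_mul_centralIdem_mul]
  simp only [component, map_add, map_sub, LinearMap.add_apply, LinearMap.sub_apply, one_mul,
    mul_one, h₁, h₂, h₃, centralIdem_mul_centralIdem_mul]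
  abel

theorem component_P (ν : ℝ) (z x : E) :
    component ν (P z x) = P (component ν z) (component ν x) := by
  simp only [P_apply, component_mul]
  simp only [component, map_sub, map_smul]
  module

open Classical in
theorem SpectralDecomposition.component_eq {x : E} (s : SpectralDecomposition x) (ν : ℝ) :
    component ν x = ∑ i, (if traceL (s.idem i) = ν then s.eigenvalue i else 1) • s.idem i := by
  have h₁ : L (centralIdem E ν) x =
      ∑ i, (if traceL (s.idem i) = ν then s.eigenvalue i else 0) • s.idem i := by
    conv_lhs => rw [s.sum_eq]
    rw [map_sum]
    refine Finset.sum_congr rfl fun i _ => ?_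
    rw [map_smul, centralIdem_mul_primitive ν (s.primitive i)]
    split_ifs <;> simp
  have h₂ : centralIdem E ν = ∑ i, (if traceL (s.idem i) = ν then (1 : ℝ) else 0) • s.idem i := by
    rw [← mul_one (centralIdem E ν), ← s.sum_idem, map_sum]
    refine Finset.sum_congr rfl fun i _ => ?_
    rw [centralIdem_mul_primitive ν (s.primitive i)]
    split_ifs <;> simp
  have h₃ : one - centralIdem E ν =
      ∑ i, (if traceL (s.idem i) = ν then (0 : ℝ) else 1) • s.idem i := by
    rw [h₂, ← s.sum_idem, ← Finset.sum_sub_distrib]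
    refine Finset.sum_congr rfl fun i _ => ?_
    split_ifs <;> simp
  rw [component, h₁, h₃, ← Finset.sum_add_distrib]
  refine Finset.sum_congr rfl fun i _ => ?_
  split_ifs <;> simp

theorem SpectralDecomposition.eigenvalue_ne_zero {x : E} (s : SpectralDecomposition x)
    (h : LinearMap.det (P x) ≠ 0) (i : Fin s.r) : s.eigenvalue i ≠ 0 :=
  s.isCompleteSystem.ne_zero_of_det_P_ne_zero (s.sum_eq ▸ h) i (s.primitive i).2.1

theorem det_P_component_ne_zero (ν : ℝ) {x : E} (h : LinearMap.det (P x) ≠ 0) :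
    LinearMap.det (P (component ν x)) ≠ 0 := by
  classical
  obtain ⟨s⟩ := nonempty_spectralDecomposition x
  rw [s.component_eq ν]
  refine (s.isCompleteSystem.log_det_P fun i => ?_).1
  split_ifs
  · exact s.eigenvalue_ne_zero h i
  · exact one_ne_zero

/-- The logarithm of the absolute value of the determinant, expressed by the quadratic
representation. -/
def logDet (x : E) : ℝ :=
  ∑ ν ∈ traceValues E, (2 * ν)⁻¹ * Real.log (LinearMap.det (P (component ν x)))

/-- Passing to the component for `ν` keeps just the eigenvalues whose idempotent has trace `ν`, each
with weight `2ν`, which the factor `(2ν)⁻¹` cancels. -/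
theorem SpectralDecomposition.logDet_eq {x : E} (s : SpectralDecomposition x)
    (h : ∀ i, s.eigenvalue i ≠ 0) : logDet x = ∑ i, Real.log (s.eigenvalue i) := by
  classical
  have h₁ : ∀ ν, Real.log (LinearMap.det (P (component ν x))) =
      ∑ i, if traceL (s.idem i) = ν then 2 * ν * Real.log (s.eigenvalue i) else 0 := by
    intro ν
    rw [s.component_eq ν, (s.isCompleteSystem.log_det_P fun i => ?_).2]
    · refine Finset.sum_congr rfl fun i _ => ?_
      split_ifs with hi
      · rw [hi]
      · rw [Real.log_one, mul_zero]
    · split_ifs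
      · exact h i
      · exact one_ne_zero
  simp only [logDet, h₁, Finset.mul_sum]
  rw [Finset.sum_comm]
  refine Finset.sum_congr rfl fun i _ => ?_
  rw [Finset.sum_eq_single (traceL (s.idem i))]
  · have := ((s.primitive i).1.traceL_pos (s.primitive i).2.1).ne'
    rw [if_pos rfl]
    field_simp
  · intro ν _ hν
    rw [if_neg hν.symm, mul_zero]
  · intro hn; exact absurd (s.primitive i).traceL_mem hn

theorem logDet_P {z x : E} (hz : LinearMap.det (P z) ≠ 0) (hx : LinearMap.det (P x) ≠ 0) :
    logDet (P z x) = 2 * logDet z + logDet x := by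
  simp only [logDet, Finset.mul_sum, ← Finset.sum_add_distrib]
  refine Finset.sum_congr rfl fun ν _ => ?_
  have h₁ := det_P_component_ne_zero ν hz
  have h₂ := det_P_component_ne_zero ν hx
  rw [component_P, det_P_P, Real.log_mul (pow_ne_zero 2 h₁) h₂, Real.log_pow]
  push_cast; ring

theorem continuous_mul : Continuous fun p : E × E => L p.1 p.2 := by
  let f : E →L[ℝ] E →L[ℝ] E := LinearMap.toContinuousLinearMap
    ((LinearMap.toContinuousLinearMap : (E →ₗ[ℝ] E) ≃ₗ[ℝ] (E →L[ℝ] E)).toLinearMap ∘ₗ L)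
  exact (f.continuous.comp continuous_fst).clm_apply continuous_snd

theorem continuous_det_P : Continuous fun x : E => LinearMap.det (P x) := by
  classical
  have b := stdOrthonormalBasis ℝ E
  have h : ∀ x : E, LinearMap.det (P x) =
      (Matrix.of fun i j => inner ℝ (b i) (P x (b j))).det := by
    intro x
    rw [← LinearMap.det_toMatrix b.toBasis]
    congr 1
    ext i j
    rw [LinearMap.toMatrix_apply]
    simp [OrthonormalBasis.repr_apply_apply]
  simp only [h]
  refine Continuous.matrix_det (continuous_matrix fun i j => ?_)
  have hL : ∀ {f g : E → E}, Continuous f → Continuous g → Continuous fun x => L (f x) (g x) :=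
    fun hf hg => continuous_mul.comp (hf.prodMk hg)
  refine Continuous.inner continuous_const ?_
  simp only [P_apply]
  exact ((hL continuous_id (hL continuous_id continuous_const)).const_smul (2 : ℝ)).sub
    (hL (hL continuous_id continuous_id) continuous_const)

theorem continuousOn_logDet : ContinuousOn logDet {x : E | LinearMap.det (P x) ≠ 0} := by
  refine continuousOn_finsetSum _ fun ν _ => continuousOn_const.mul ?_
  refine ContinuousOn.log ?_ fun x hx => det_P_component_ne_zero ν hx
  have hc : Continuous (component ν : E → E) :=
    (LinearMap.continuous_of_finiteDimensional _).add continuous_const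
  exact (continuous_det_P.comp hc).continuousOn

/-! ### The cone -/

theorem SpectralDecomposition.inner_idem {x : E} (s : SpectralDecomposition x) (i : Fin s.r) :
    inner ℝ (s.idem i) x = s.eigenvalue i * ‖s.idem i‖ ^ 2 := by
  have h := s.isCompleteSystem.inner_sum_right i s.eigenvalue
  rwa [← s.sum_eq] at h

theorem SpectralDecomposition.eigenvalue_nonneg {x : E} (s : SpectralDecomposition x)
    (h : ∀ d : E, IsIdempotent d → 0 ≤ inner ℝ d x) (i : Fin s.r) : 0 ≤ s.eigenvalue i := by
  have h₁ := h _ (s.primitive i).1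
  rw [s.inner_idem] at h₁
  have : 0 < ‖s.idem i‖ := norm_pos_iff.2 (s.primitive i).2.1
  exact nonneg_of_mul_nonneg_left h₁ (by positivity)

/-- Half of the self-duality of the cone: membership becomes a family of linear inequalities, from
which convexity and scaling are immediate. -/
theorem exists_eq_sq_iff (x : E) :
    (∃ y : E, x = L y y) ↔ ∀ d : E, IsIdempotent d → 0 ≤ inner ℝ d x := by
  constructor
  · rintro ⟨y, rfl⟩ d hd
    rw [inner_mul]
    exact hd.inner_mul_self_nonneg y
  · intro h
    obtain ⟨s⟩ := nonempty_spectralDecomposition x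
    refine ⟨∑ i, √(s.eigenvalue i) • s.idem i, ?_⟩
    rw [s.isCompleteSystem.sum_mul_sum]
    simp only [Real.mul_self_sqrt (s.eigenvalue_nonneg h _)]
    exact s.sum_eq

theorem convex_squares : Convex ℝ {x : E | ∃ y : E, x = L y y} := by
  intro x hx y hy a b ha hb _
  rw [Set.mem_ofPred_eq, exists_eq_sq_iff] at *
  intro d hd
  rw [inner_add_right, inner_smul_right, inner_smul_right]
  exact add_nonneg (mul_nonneg ha (hx d hd)) (mul_nonneg hb (hy d hd))

theorem isOpen_cone : IsOpen (cone E) := isOpen_interior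

open scoped Pointwise in
theorem smul_mem_cone {t : ℝ} (ht : 0 < t) {x : E} (hx : x ∈ cone E) : t • x ∈ cone E := by
  have h : t • cone E = cone E := by
    rw [cone, ← interior_smul₀ ht.ne']
    congr 1
    ext x
    rw [Set.mem_smul_set_iff_inv_smul_mem₀ ht.ne', Set.mem_ofPred_eq, Set.mem_ofPred_eq,
      exists_eq_sq_iff, exists_eq_sq_iff]
    refine forall₂_congr fun d _ => ?_
    rw [inner_smul_right, mul_nonneg_iff_of_pos_left (inv_pos.2 ht)]
  exact h ▸ Set.smul_mem_smul_set hx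

theorem add_mem_cone {x y : E} (hx : x ∈ cone E) (hy : y ∈ cone E) : x + y ∈ cone E := by
  have h := convex_squares.interior hx hy (a := 1 / 2) (b := 1 / 2) (by norm_num) (by norm_num)
    (by norm_num)
  have h₂ := smul_mem_cone two_pos h
  rwa [smul_add, smul_smul, smul_smul, mul_one_div_cancel two_ne_zero, one_smul, one_smul] at h₂

variable (E) in
theorem one_mem_cone : (one : E) ∈ cone E := by
  obtain ⟨δ, hδ, hle⟩ := exists_le_norm_of_isIdempotent E
  rw [cone, mem_interior_iff_mem_nhds]
  -- For `‖x - e‖ < δ ≤ ‖d‖` one has `⟨d, x⟩ = ‖d‖² + ⟨d, x - e⟩ ≥ ‖d‖(‖d‖ - δ)`.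
  refine Filter.mem_of_superset (Metric.ball_mem_nhds one hδ) fun x hx => ?_
  rw [Set.mem_ofPred_eq, exists_eq_sq_iff]
  intro d hd
  by_cases h₀ : d = 0
  · simp [h₀]
  rw [mem_ball_iff_norm] at hx
  have h₁ : inner ℝ d x = ‖d‖ ^ 2 + inner ℝ d (x - one) := by
    rw [inner_sub_right, real_inner_comm one d, inner_one_left d hd, real_inner_self_eq_norm_sq]
    ring
  have h₂ := (abs_le.1 (abs_real_inner_le_norm d (x - one))).1
  have h₃ := hle d hd h₀
  rw [h₁]
  nlinarith [norm_nonneg d, norm_nonneg (x - one)]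

/-- By openness `x - t e` is still a square for some `t > 0`, which bounds each eigenvalue below by
`t`. -/
theorem SpectralDecomposition.eigenvalue_pos {x : E} (s : SpectralDecomposition x)
    (hx : x ∈ cone E) (i : Fin s.r) : 0 < s.eigenvalue i := by
  have h : ∀ᶠ t : ℝ in nhdsWithin 0 (Set.Ioi 0), x - t • one ∈ cone E := by
    have hc : Filter.Tendsto (fun t : ℝ => x - t • (one : E)) (nhds 0) (nhds x) := by
      have : Continuous fun t : ℝ => x - t • (one : E) := by fun_prop
      simpa using this.tendsto 0
    exact (hc.mono_left nhdsWithin_le_nhds).eventually (isOpen_cone.mem_nhds hx)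
  obtain ⟨t, ht, ht₀⟩ := (h.and self_mem_nhdsWithin).exists
  have hsq : ∃ y : E, x - t • one = L y y := (interior_subset ht :)
  have h₁ := (exists_eq_sq_iff _).1 hsq _ (s.primitive i).1
  rw [inner_sub_right, s.inner_idem, inner_smul_right, real_inner_comm,
    inner_one_left _ (s.primitive i).1, real_inner_self_eq_norm_sq, ← sub_mul] at h₁
  have : 0 < ‖s.idem i‖ := norm_pos_iff.2 (s.primitive i).2.1
  have h₂ := nonneg_of_mul_nonneg_left h₁ (by positivity)
  have : 0 < t := ht₀
  linarith

theorem SpectralDecomposition.det_P_ne_zero {x : E} (s : SpectralDecomposition x)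
    (h : ∀ i, s.eigenvalue i ≠ 0) : LinearMap.det (P x) ≠ 0 := by
  have h' := (s.isCompleteSystem.log_det_P h).1
  rwa [← s.sum_eq] at h'

theorem det_P_ne_zero_of_mem_cone {x : E} (hx : x ∈ cone E) : LinearMap.det (P x) ≠ 0 := by
  obtain ⟨s⟩ := nonempty_spectralDecomposition x
  exact s.det_P_ne_zero fun i => (s.eigenvalue_pos hx i).ne'

theorem log_det_eq_logDet {x : E} (hx : LinearMap.det (P x) ≠ 0) :
    Real.log (det x) = logDet x := by
  have h := nonempty_spectralDecomposition x
  rw [det, dif_pos h, Real.log_prod fun i _ => h.some.eigenvalue_ne_zero hx i,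
    h.some.logDet_eq (h.some.eigenvalue_ne_zero hx)]

theorem continuousOn_log_det : ContinuousOn (fun x : E => Real.log (det x)) (cone E) :=
  (continuousOn_logDet.mono fun _ hx => det_P_ne_zero_of_mem_cone hx).congr fun _ hx =>
    log_det_eq_logDet (det_P_ne_zero_of_mem_cone hx)

/-- The decomposition of `∑ i, f i • c i` for the idempotents `c i` of a decomposition of `x`. -/
def SpectralDecomposition.withEigenvalues {x : E} (s : SpectralDecomposition x)
    (f : Fin s.r → ℝ) : SpectralDecomposition (∑ i, f i • s.idem i) :=
  ⟨s.r, s.idem, f, s.primitive, s.orthogonal, s.sum_idem, rfl⟩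

theorem SpectralDecomposition.power_eq {x : E} (s : SpectralDecomposition x) (p : ℝ) :
    power x p = ∑ i, s.eigenvalue i ^ p • s.idem i := by
  have h : Nonempty (SpectralDecomposition x) := ⟨s⟩
  rw [power, dif_pos h]
  exact h.some.isCompleteSystem.sum_apply_smul_eq s.isCompleteSystem
    (h.some.sum_eq.symm.trans s.sum_eq) fun t => t ^ p

variable (E) in
/-- The number of elements of a complete system of primitive orthogonal idempotents. -/
def rank : ℕ := (referenceFrame E).r

theorem SpectralDecomposition.r_eq_rank {x : E} (s : SpectralDecomposition x) : s.r = rank E := by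
  -- Evaluating `logDet` at twice the unit counts the idempotents of any decomposition.
  have key : ∀ {z : E} (s : SpectralDecomposition z), logDet ((2 : ℝ) • one : E) =
      s.r * Real.log 2 := by
    intro z s
    have h : (2 : ℝ) • one = ∑ i, (2 : ℝ) • s.idem i := by rw [← Finset.smul_sum, s.sum_idem]
    rw [h, (s.withEigenvalues fun _ => 2).logDet_eq fun _ => two_ne_zero]
    change ∑ _i : Fin s.r, Real.log 2 = _
    simp
  have h := (key s).symm.trans (key (referenceFrame E))
  exact_mod_cast mul_right_cancel₀ (Real.log_pos one_lt_two).ne' h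

theorem log_det_smul {t : ℝ} (ht : 0 < t) {x : E} (hx : x ∈ cone E) :
    Real.log (det (t • x)) = rank E * Real.log t + Real.log (det x) := by
  obtain ⟨s⟩ := nonempty_spectralDecomposition x
  have hp := s.eigenvalue_pos hx
  rw [log_det_eq_logDet (det_P_ne_zero_of_mem_cone hx),
    log_det_eq_logDet (det_P_ne_zero_of_mem_cone (smul_mem_cone ht hx)),
    s.logDet_eq fun i => (hp i).ne']
  have h : t • x = ∑ i, (t * s.eigenvalue i) • s.idem i := by
    simp only [mul_smul]
    rw [← Finset.smul_sum, ← s.sum_eq]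
  rw [h, (s.withEigenvalues fun i => t * s.eigenvalue i).logDet_eq
    fun i => (mul_pos ht (hp i)).ne', ← s.r_eq_rank]
  change ∑ i : Fin s.r, Real.log (t * s.eigenvalue i) = _
  simp only [Real.log_mul ht.ne' (hp _).ne', Finset.sum_add_distrib]
  simp

theorem power_smul {t : ℝ} (ht : 0 < t) {x : E} (hx : x ∈ cone E) (p : ℝ) :
    power (t • x) p = t ^ p • power x p := by
  obtain ⟨s⟩ := nonempty_spectralDecomposition x
  have h : t • x = ∑ i, (t * s.eigenvalue i) • s.idem i := by
    simp only [mul_smul]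
    rw [← Finset.smul_sum, ← s.sum_eq]
  rw [s.power_eq, h, (s.withEigenvalues fun i => t * s.eigenvalue i).power_eq, Finset.smul_sum]
  refine Finset.sum_congr rfl fun i _ => ?_
  change (t * s.eigenvalue i) ^ p • s.idem i = _
  rw [Real.mul_rpow ht.le (s.eigenvalue_pos hx i).le, mul_smul]

theorem P_power_smul_smul {t : ℝ} (ht : 0 < t) {z : E} (hz : z ∈ cone E) (x : E) :
    P (power (t • z) (-1 / 2)) (t • x) = P (power z (-1 / 2)) x := by
  have h : t ^ (-1 / 2 : ℝ) * t ^ (-1 / 2 : ℝ) * t = 1 := by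
    rw [← Real.rpow_add ht, ← Real.rpow_add_one ht.ne']
    norm_num
  rw [power_smul ht hz]
  generalize t ^ (-1 / 2 : ℝ) = u at h
  have hP : ∀ w : E, P (u • w) (t • x) = (u * u * t) • P w x := fun w => by
    simp only [P_apply, map_smul, LinearMap.smul_apply]
    module
  rw [hP, h, one_smul]

theorem P_power_self {z : E} (hz : z ∈ cone E) : P (power z (-1 / 2)) z = one := by
  obtain ⟨s⟩ := nonempty_spectralDecomposition z
  rw [s.power_eq]
  have h := s.isCompleteSystem.P_sum (fun i => s.eigenvalue i ^ (-1 / 2 : ℝ)) s.eigenvalue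
  rw [← s.sum_eq] at h
  rw [h, ← s.sum_idem]
  refine Finset.sum_congr rfl fun i _ => ?_
  have hi := s.eigenvalue_pos hz i
  have : (s.eigenvalue i ^ (-1 / 2 : ℝ)) ^ 2 * s.eigenvalue i = 1 := by
    rw [← Real.rpow_natCast, ← Real.rpow_mul hi.le, ← Real.rpow_add_one hi.ne']
    norm_num
  rw [this, one_smul]

theorem log_det_P_power {z x : E} (hz : z ∈ cone E) (hx : x ∈ cone E) :
    Real.log (det (P (power z (-1 / 2)) x)) = Real.log (det x) - Real.log (det z) := by
  obtain ⟨s⟩ := nonempty_spectralDecomposition z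
  have hp := s.eigenvalue_pos hz
  let s' := s.withEigenvalues fun i => s.eigenvalue i ^ (-1 / 2 : ℝ)
  have hs' : ∀ i, s'.eigenvalue i ≠ 0 := fun i => (Real.rpow_pos_of_pos (hp i) _).ne'
  have h₁ := s'.det_P_ne_zero hs'
  have h₂ := det_P_ne_zero_of_mem_cone hx
  have h₃ := s'.logDet_eq hs'
  have hpow := s.power_eq (-1 / 2)
  rw [← hpow] at h₁
  have h₄ : logDet (power z (-1 / 2)) = -(1 / 2) * logDet z := by
    rw [hpow, h₃, s.logDet_eq fun i => (hp i).ne', Finset.mul_sum]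
    refine Finset.sum_congr rfl fun i _ => ?_
    change Real.log (s.eigenvalue i ^ (-1 / 2 : ℝ)) = _
    rw [Real.log_rpow (hp i)]
    ring
  rw [log_det_eq_logDet (by rw [det_P_P]; exact mul_ne_zero (pow_ne_zero 2 h₁) h₂),
    log_det_eq_logDet h₂, log_det_eq_logDet (det_P_ne_zero_of_mem_cone hz), logDet_P h₁ h₂, h₄]
  ring

end

end EuclideanJordanAlgebra

/-! ### Pexider's equation on an open cone -/

section Pexider

variable {E : Type*} [NormedAddCommGroup E] [InnerProductSpace ℝ E] {V : Set E}

theorem exists_add_smul_mem_of_isOpen (hV : IsOpen V)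
    (hsmul : ∀ t : ℝ, 0 < t → ∀ x ∈ V, t • x ∈ V) {v : E} (hv : v ∈ V) (h : E) :
    ∃ t : ℝ, 0 < t ∧ h + t • v ∈ V := by
  have hc : Filter.Tendsto (fun t : ℝ => t • h + v) (nhds 0) (nhds v) := by
    have : Continuous fun t : ℝ => t • h + v := by fun_prop
    simpa using this.tendsto 0
  have hev : ∀ᶠ t : ℝ in nhdsWithin 0 (Set.Ioi 0), t • h + v ∈ V :=
    (hc.mono_left nhdsWithin_le_nhds).eventually (hV.mem_nhds hv)
  obtain ⟨t, ht, ht₀⟩ := (hev.and self_mem_nhdsWithin).exists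
  have ht₀ : 0 < t := ht₀
  refine ⟨t⁻¹, inv_pos.2 ht₀, ?_⟩
  have := hsmul t⁻¹ (inv_pos.2 ht₀) _ ht
  rwa [smul_add, smul_smul, inv_mul_cancel₀ ht₀.ne', one_smul] at this

theorem eq_zero_of_inner_eq_const (hV : IsOpen V) (hne : V.Nonempty)
    (hsmul : ∀ t : ℝ, 0 < t → ∀ x ∈ V, t • x ∈ V) {w : E} {k : ℝ}
    (h : ∀ x ∈ V, inner ℝ w x = k) : w = 0 ∧ k = 0 := by
  obtain ⟨v, hv⟩ := hne
  have hk : k = 0 := by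
    have h₁ := h _ (hsmul 2 two_pos v hv)
    rw [inner_smul_right, h v hv] at h₁
    linarith
  refine ⟨?_, hk⟩
  obtain ⟨t, ht, hmem⟩ := exists_add_smul_mem_of_isOpen hV hsmul hv w
  have h₁ := h _ hmem
  rw [inner_add_right, inner_smul_right, h v hv, hk, mul_zero, add_zero] at h₁
  exact inner_self_eq_zero.1 h₁

/-- A continuous additive function on an open convex cone is the restriction of a linear form. -/
theorem exists_inner_eq_of_additive_on [CompleteSpace E] (hV : IsOpen V) (hne : V.Nonempty)
    (hadd : ∀ x ∈ V, ∀ y ∈ V, x + y ∈ V) (hsmul : ∀ t : ℝ, 0 < t → ∀ x ∈ V, t • x ∈ V)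
    {G : E → ℝ} (hG : ContinuousOn G V) (h : ∀ x ∈ V, ∀ y ∈ V, G (x + y) = G x + G y) :
    ∃ w : E, ∀ x ∈ V, G x = inner ℝ w x := by
  obtain ⟨v, hv⟩ := hne
  choose t ht hmem using exists_add_smul_mem_of_isOpen hV hsmul hv
  have htv : ∀ x, t x • v ∈ V := fun x => hsmul _ (ht x) v hv
  -- The difference `G (x + y) - G y` does not depend on `y`, so it defines the extension of `G` to
  -- the whole space.
  have key : ∀ x, ∀ y ∈ V, x + y ∈ V →
      G (x + t x • v) - G (t x • v) = G (x + y) - G y := by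
    intro x y hy hxy
    have h₁ := h _ (hmem x) y hy
    have h₂ := h _ hxy _ (htv x)
    have : x + t x • v + y = x + y + t x • v := by abel
    rw [this] at h₁
    linarith
  let F : E →+ ℝ := AddMonoidHom.mk' (fun x => G (x + t x • v) - G (t x • v)) <| by
    intro x y
    have h₁ := key (x + y) (t x • v + t y • v) (hadd _ (htv x) _ (htv y))
      (by
        have := hadd _ (hmem x) _ (hmem y)
        rwa [add_add_add_comm] at this)
    rw [h₁, add_add_add_comm, h _ (hmem x) _ (hmem y), h _ (htv x) _ (htv y)]
    ring
  have hF : Continuous F := by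
    refine continuous_of_continuousAt_zero F ?_
    have hev : (fun x => G (x + v) - G v) =ᶠ[nhds 0] F := by
      have hc : Filter.Tendsto (fun x : E => x + v) (nhds 0) (nhds v) := by
        have : Continuous fun x : E => x + v := by fun_prop
        simpa using this.tendsto 0
      filter_upwards [hc.eventually (hV.mem_nhds hv)] with x hx
      exact (key x v hv hx).symm
    refine ContinuousAt.congr ?_ hev
    have hGv : ContinuousAt G (0 + v) := by
      rw [zero_add]; exact hG.continuousAt (hV.mem_nhds hv)
    exact (ContinuousAt.comp (f := fun x : E => x + v) hGv (by fun_prop)).sub continuousAt_const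
  refine ⟨(InnerProductSpace.toDual ℝ E).symm (F.toRealLinearMap hF), fun x hx => ?_⟩
  rw [InnerProductSpace.toDual_symm_apply]
  change G x = G (x + t x • v) - G (t x • v)
  rw [h x hx _ (htv x)]
  ring

theorem exists_of_pexider [CompleteSpace E] (hV : IsOpen V) (hne : V.Nonempty)
    (hadd : ∀ x ∈ V, ∀ y ∈ V, x + y ∈ V) (hsmul : ∀ t : ℝ, 0 < t → ∀ x ∈ V, t • x ∈ V)
    {A B C : E → ℝ} (hA : ContinuousOn A V)
    (h : ∀ x ∈ V, ∀ y ∈ V, A x + B y = C (x + y)) :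
    ∃ (w : E) (α β : ℝ), (∀ x ∈ V, A x = inner ℝ w x + α) ∧ (∀ x ∈ V, B x = inner ℝ w x + β) ∧
      ∀ x ∈ V, C x = inner ℝ w x + (α + β) := by
  obtain ⟨v, hv⟩ := hne
  -- `C (x + y + u)` is computed in two ways. The right side is free of `x`, so the increment of `A`
  -- by `y` does not depend on the base point and is additive in `y`.
  have key : ∀ x ∈ V, ∀ y ∈ V, ∀ u ∈ V, A (x + y) - A x = B (y + u) - B u := by
    intro x hx y hy u hu
    have h₁ := h _ (hadd x hx y hy) u hu
    have h₂ := h x hx _ (hadd y hy u hu)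
    rw [← add_assoc] at h₂
    linarith
  have hG : ∀ x ∈ V, ∀ y ∈ V, A (x + y) - A x = A (v + y) - A v := fun x hx y hy =>
    (key x hx y hy v hv).trans (key v hv y hy v hv).symm
  obtain ⟨w, hw⟩ := exists_inner_eq_of_additive_on hV ⟨v, hv⟩ hadd hsmul
    (G := fun y => A (v + y) - A v)
    ((hA.comp (by fun_prop) fun y hy => hadd v hv y hy).sub continuousOn_const) (by
      intro x hx y hy
      have h₁ := hG _ (hadd v hv x hx) y hy
      rw [add_assoc] at h₁
      linarith)
  have hA' : ∀ x ∈ V, A x = inner ℝ w x + (A v - inner ℝ w v) := by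
    intro x hx
    have h₁ := hG x hx v hv
    have h₂ := hw v hv
    have h₃ := hw x hx
    rw [add_comm x v] at h₁
    linarith
  have hB' : ∀ x ∈ V, B x = inner ℝ w x + (B v - inner ℝ w v) := by
    intro x hx
    have h₁ := key v hv x hx v hv
    have h₂ := key v hv v hv x hx
    have h₃ := hw v hv
    have h₄ := hw x hx
    rw [add_comm x v] at h₁
    linarith
  refine ⟨w, _, _, hA', hB', fun x hx => ?_⟩
  have hx' := hsmul (1 / 2) (by norm_num) x hx
  have h₁ := h _ hx' _ hx'
  rw [← add_smul, add_halves, one_smul, hA' _ hx', hB' _ hx', inner_smul_right] at h₁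
  linarith

theorem exists_eq_mul_log {α : ℝ → ℝ} (hα : ContinuousOn α (Set.Ioi 0))
    (h : ∀ s, 0 < s → ∀ t, 0 < t → α (s * t) = α s + α t) :
    ∃ κ : ℝ, ∀ s, 0 < s → α s = κ * Real.log s := by
  let F : ℝ →+ ℝ := AddMonoidHom.mk' (fun u => α (Real.exp u)) fun u v => by
    rw [Real.exp_add]; exact h _ (Real.exp_pos u) _ (Real.exp_pos v)
  have hF : Continuous F := hα.comp_continuous Real.continuous_exp fun u => Real.exp_pos u
  refine ⟨F 1, fun s hs => ?_⟩
  have h₁ := (F.toRealLinearMap hF).map_smul (Real.log s) 1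
  rw [smul_eq_mul, _root_.mul_one, smul_eq_mul, _root_.mul_comm] at h₁
  rw [← Real.exp_log hs]
  change F (Real.log s) = _
  rw [Real.exp_log hs]
  exact h₁

/-- The functions whose increments under dilations are solutions of Pexider's equation. -/
theorem exists_dilation_increments [CompleteSpace E] (hV : IsOpen V) (hne : V.Nonempty)
    (hadd : ∀ x ∈ V, ∀ y ∈ V, x + y ∈ V) (hsmul : ∀ t : ℝ, 0 < t → ∀ x ∈ V, t • x ∈ V)
    {a b c : E → ℝ} (ha : ContinuousOn a V) (hb : ContinuousOn b V)
    (h : ∀ s : ℝ, 0 < s → ∀ x ∈ V, ∀ y ∈ V,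
      (a (s • x) - a x) + (b (s • y) - b y) = c (s • (x + y)) - c (x + y)) :
    ∃ (w : E) (κ₁ κ₂ : ℝ), ∀ s : ℝ, 0 < s → ∀ x ∈ V,
      a (s • x) - a x = (s - 1) * inner ℝ w x + κ₁ * Real.log s ∧
      b (s • x) - b x = (s - 1) * inner ℝ w x + κ₂ * Real.log s ∧
      c (s • x) - c x = (s - 1) * inner ℝ w x + (κ₁ + κ₂) * Real.log s := by
  have hP : ∀ s : ℝ, 0 < s → ∃ (w : E) (α β : ℝ), (∀ x ∈ V, a (s • x) - a x = inner ℝ w x + α) ∧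
      (∀ x ∈ V, b (s • x) - b x = inner ℝ w x + β) ∧
      ∀ x ∈ V, c (s • x) - c x = inner ℝ w x + (α + β) := fun s hs =>
    exists_of_pexider hV hne hadd hsmul
      ((ha.comp (by fun_prop) fun x hx => hsmul s hs x hx).sub ha) (h s hs)
  choose! w α β hA hB hC using hP
  -- A dilation by `s t` is one by `t` followed by one by `s`; an affine function vanishing on the
  -- open cone has zero coefficients.
  have hcocycle : ∀ (f : E → ℝ) (γ : ℝ → ℝ),
      (∀ s, 0 < s → ∀ x ∈ V, f (s • x) - f x = inner ℝ (w s) x + γ s) →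
      ∀ s, 0 < s → ∀ t, 0 < t → w (s * t) = t • w s + w t ∧ γ (s * t) = γ s + γ t := by
    intro f γ hf s hs t ht
    have h₁ : ∀ x ∈ V, inner ℝ (w (s * t) - t • w s - w t) x = γ s + γ t - γ (s * t) := by
      intro x hx
      have e₁ := hf _ (mul_pos hs ht) x hx
      have e₂ := hf s hs _ (hsmul t ht x hx)
      have e₃ := hf t ht x hx
      rw [mul_smul] at e₁
      rw [inner_smul_right] at e₂
      rw [inner_sub_left, inner_sub_left, inner_smul_left, conj_trivial]
      linarith
    obtain ⟨h₂, h₃⟩ := eq_zero_of_inner_eq_const hV hne hsmul h₁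
    exact ⟨by rw [sub_sub, sub_eq_zero] at h₂; exact h₂, by linarith⟩
  -- The cocycle rule for `s * 2` and `2 * s` gives `2 w s + w 2 = s w 2 + w s`.
  have hw : ∀ s, 0 < s → w s = (s - 1) • w 2 := by
    intro s hs
    have h₁ := (hcocycle a α hA s hs 2 two_pos).1
    have h₂ := (hcocycle a α hA 2 two_pos s hs).1
    rw [_root_.mul_comm] at h₂
    linear_combination (norm := module) h₂ - h₁
  have hlog : ∀ (f : E → ℝ) (γ : ℝ → ℝ), ContinuousOn f V →
      (∀ s, 0 < s → ∀ x ∈ V, f (s • x) - f x = inner ℝ (w s) x + γ s) →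
      ∃ κ : ℝ, ∀ s, 0 < s → γ s = κ * Real.log s := by
    intro f γ hfc hf
    refine exists_eq_mul_log ?_ fun s hs t ht => (hcocycle f γ hf s hs t ht).2
    obtain ⟨v, hv⟩ := hne
    have hcont : ContinuousOn (fun s : ℝ => f (s • v) - f v - inner ℝ ((s - 1) • w 2) v)
        (Set.Ioi 0) := by
      refine ((hfc.comp (by fun_prop) fun s hs => hsmul s hs v hv).sub continuousOn_const).sub ?_
      fun_prop
    refine hcont.congr fun s hs => ?_
    change γ s = f (s • v) - f v - inner ℝ ((s - 1) • w 2) v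
    rw [hf s hs v hv, hw s hs]
    ring
  obtain ⟨κ₁, hκ₁⟩ := hlog a α ha hA
  obtain ⟨κ₂, hκ₂⟩ := hlog b β hb hB
  refine ⟨w 2, κ₁, κ₂, fun s hs x hx => ?_⟩
  have hi : inner ℝ (w s) x = (s - 1) * inner ℝ (w 2) x := by
    rw [hw s hs, inner_smul_left, conj_trivial]
  rw [hA s hs x hx, hB s hs x hx, hC s hs x hx, hκ₁ s hs, hκ₂ s hs, hi]
  exact ⟨rfl, rfl, by ring⟩

end Pexider

/-! ### Solution of the Olkin–Baker equation up to dilation-invariant functions. -/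

open EuclideanJordanAlgebra in
theorem propositionT1 {E : Type*} [NormedAddCommGroup E] [InnerProductSpace ℝ E]
    [FiniteDimensional ℝ E] [EuclideanJordanAlgebra E]
    (a b c d : E → ℝ)
    (ha : ContinuousOn a (cone E)) (hb : ContinuousOn b (cone E))
    (hc : ContinuousOn c (cone E)) (hd : ContinuousOn d (unitInterval E))
    (heq : OlkinBaker a b c d) :
    ∃ (k₁ k₂ : ℝ) (Λ : E) (e f g h : E → ℝ),
      (∀ x ∈ cone E, a x = inner ℝ Λ x + k₁ * Real.log (det x) + e x) ∧
      (∀ x ∈ cone E, b x = inner ℝ Λ x + k₂ * Real.log (det x) + f x) ∧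
      (∀ x ∈ cone E, c x = inner ℝ Λ x + (k₁ + k₂) * Real.log (det x) + g x) ∧
      (∀ u ∈ unitInterval E,
        d u = k₁ * Real.log (det u) + k₂ * Real.log (det (one - u)) + h u) ∧
      ContinuousOn e (cone E) ∧ ContinuousOn f (cone E) ∧ ContinuousOn g (cone E) ∧
      ContinuousOn h (unitInterval E) ∧
      OlkinBaker e f g h ∧
      (∀ s : ℝ, 0 < s → ∀ x ∈ cone E,
        e (s • x) = e x ∧ f (s • x) = f x ∧ g (s • x) = g x) := by
  obtain ⟨Λ, κ₁, κ₂, hκ⟩ := exists_dilation_increments isOpen_cone ⟨one, one_mem_cone E⟩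
    (fun x hx y hy => add_mem_cone hx hy) (fun t ht x hx => smul_mem_cone ht hx) ha hb
    (c := c) (by
      intro s hs x hx y hy
      have h₁ := heq x hx y hy
      have h₂ := heq _ (smul_mem_cone hs hx) _ (smul_mem_cone hs hy)
      rw [← smul_add, P_power_smul_smul hs (add_mem_cone hx hy)] at h₂
      linarith)
  -- The constants are rescaled because `log det (s x)` grows by `rank * log s`.
  have hrank : ∃ k₁ k₂ : ℝ, ∀ s : ℝ, 0 < s → κ₁ * Real.log s = k₁ * (rank E * Real.log s) ∧
      κ₂ * Real.log s = k₂ * (rank E * Real.log s) := by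
    by_cases hr : rank E = 0
    · -- the zero algebra: all increments vanish
      have hone : (one : E) = 0 := by
        rw [← (referenceFrame E).sum_idem]
        have : IsEmpty (Fin (referenceFrame E).r) := by
          rw [show (referenceFrame E).r = 0 from hr]; infer_instance
        exact Finset.sum_of_isEmpty _
      refine ⟨0, 0, fun s hs => ?_⟩
      obtain ⟨h₁, h₂, -⟩ := hκ s hs one (one_mem_cone E)
      simp only [hone, smul_zero, sub_self, inner_zero_right, mul_zero, zero_add] at h₁ h₂
      simp [← h₁, ← h₂]
    · have hr' : (rank E : ℝ) ≠ 0 := by exact_mod_cast hr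
      exact ⟨κ₁ / rank E, κ₂ / rank E, fun s _ => ⟨by field_simp, by field_simp⟩⟩
  obtain ⟨k₁, k₂, hk⟩ := hrank
  have hinner : ContinuousOn (fun x : E => inner ℝ Λ x) (cone E) := by fun_prop
  have hlog := continuousOn_log_det (E := E)
  refine ⟨k₁, k₂, Λ, fun x => a x - inner ℝ Λ x - k₁ * Real.log (det x),
    fun x => b x - inner ℝ Λ x - k₂ * Real.log (det x),
    fun x => c x - inner ℝ Λ x - (k₁ + k₂) * Real.log (det x),
    fun u => d u - k₁ * Real.log (det u) - k₂ * Real.log (det (one - u)),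
    fun x _ => by ring, fun x _ => by ring, fun x _ => by ring, fun u _ => by ring,
    (ha.sub hinner).sub (continuousOn_const.mul hlog),
    (hb.sub hinner).sub (continuousOn_const.mul hlog),
    (hc.sub hinner).sub (continuousOn_const.mul hlog), ?_, ?_, ?_⟩
  · refine (hd.sub (continuousOn_const.mul (hlog.mono fun u hu => hu.1))).sub
      (continuousOn_const.mul ?_)
    exact hlog.comp (f := fun u : E => one - u) (by fun_prop) fun u hu => hu.2
  · intro x hx y hy
    have hxy := add_mem_cone hx hy
    -- Since `P(z^(-1/2)) z = e`, the two arguments of `log det` in `d` play symmetric roles in `x`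
    -- and `y`, and all logarithms cancel.
    have h₁ : one - P (power (x + y) (-1 / 2)) x = P (power (x + y) (-1 / 2)) y := by
      rw [← P_power_self hxy, map_add, add_sub_cancel_left]
    simp only [h₁, log_det_P_power hxy hx, log_det_P_power hxy hy, inner_add_right]
    linear_combination heq x hx y hy
  · intro s hs x hx
    obtain ⟨h₁, h₂, h₃⟩ := hκ s hs x hx
    obtain ⟨h₄, h₅⟩ := hk s hs
    simp only [log_det_smul hs hx, inner_smul_right]
    refine ⟨?_, ?_, ?_⟩
    · linear_combination h₁ + h₄
    · linear_combination h₂ + h₅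
    · linear_combination h₃ + h₄ + h₅
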